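/- Let $\mathcal S,\mathcal A$ be finite sets, $\mathcal A\neq\emptyset$, $D=|\mathcal S\times\mathcal A|$, and consider a discounted Markov decision process with discount factor $\gamma\in(0,1)$, transition probabilities $P(\cdot\mid s,a)$ on $\mathcal S$, and random rewards $R(s,a)\in[0,\infty)$ with means $r(s,a)=\mathbb E R(s,a)$. A policy $\pi$ assigns to each $s\in\mathcal S$ a probability $\pi(\cdot\mid s)$ on $\mathcal A$. Put $$Q^\pi(s,a)=\mathbb E_\pi\Big[\sum_{t\ge 0}\gamma^t r(s_t,a_t)\,\Big|\,s_0=s,a_0=a\Big],\qquad V^\pi(s)=\sum_{a}\pi(a\mid s)Q^\pi(s,a),\qquad Q^*(s,a)=\max_\pi Q^\pi(s,a),$$ where $\mathbb E_\pi$ refers to the trajectory with $s_{t+1}\sim P(\cdot\mid s_t,a_t)$, $a_{t+1}\sim\pi(\cdot\mid s_{t+1})$. A policy is optimal if it attains $V^*(s)=\max_\pi V^\pi(s)$ for every $s$. Let $P^\pi\in\mathbb R^{D\times D}$ be the matrix with entries $P^\pi((s,a),(s',a'))=P(s'\mid s,a)\,\pi(a'\mid s')$. For $t\ge1$ let $(r_t(s,a),s_t(s,a))_{(s,a)}$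 be samples with $r_t(s,a)\sim R(s,a)$ and $s_t(s,a)\sim P(\cdot\mid s,a)$, all of them mutually independent (over $t$, over $(s,a)$, and rewards from next states). Given step sizes $(\eta_t)_{t\ge0}$ in $(0,1]$ and an arbitrary deterministic $Q_0\in\mathbb R^D$, let $$Q_t(s,a)=(1-\eta_t)Q_{t-1}(s,a)+\eta_t\,(\widehat{\mathcal T}_tQ_{t-1})(s,a),\qquad (\widehat{\mathcal T}_tQ)(s,a)=r_t(s,a)+\gamma\max_{a'}Q(s_t(s,a),a'),$$ and $\bar Q_T=\frac1T\sum_{t=1}^TQ_t$. Let $(\mathcal TQ)(s,a)=r(s,a)+\gamma\sum_{s'}P(s'\mid s,a)\max_{a'}Q(s',a')$, let $Z_t=\widehat{\mathcal T}_t(Q^*)-\mathcal T(Q^*)$, and let $\mathrm{Var}(Z)=\mathbb E Z_tZ_t^\top$, which does not depend on $t$. Assume: 1. $\mathbb E|R(s,a)|^4<\infty$ for all $(s,a)$. 2. There are an optimal policy $\pi^*$ and a constant $L$ such that for every $Q\in\mathbb R^D$, $\|(P^{\pi_Q}-P^{\pi^*})(Q-Q^*)\|_\infty\le L\|Q-Q^*\|_\infty^2$,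 where $\pi_Q$ is a greedy policy with respect to $Q$, i.e. $\pi_Q(\cdot\mid s)$ is supported on $\arg\max_aQ(s,a)$ for each $s$, with ties broken by any fixed rule (possibly randomized). 3. (i) $\eta_t$ is nonincreasing in $t$ with $\eta_t\to0$, and $t\eta_t$ is nondecreasing in $t$ with $t\eta_t\to\infty$; (ii) $\frac{\eta_{t-1}-\eta_t}{\eta_{t-1}}=o(\eta_{t-1})$; (iii) $\frac1{\sqrt T}\sum_{t=0}^T\eta_t\to0$ as $T\to\infty$; (iv) there is a constant $C$ with $\frac{\sum_{t=0}^T\eta_t}{T\eta_T}\le C$ for all $T\ge1$. Then $I-\gamma P^{\pi^*}$ is invertible, the matrix $$\mathrm{Var}_Q=(I-\gamma P^{\pi^*})^{-1}\,\mathrm{Var}(Z)\,(I-\gamma P^{\pi^*})^{-\top}$$ is positive semidefinite, and, as $T\to\infty$, $$\sqrt T\,(\bar Q_T-Q^*)\ \xrightarrow{d}\ \mathcal N(0,\mathrm{Var}_Q).$$ -/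

import Mathlib

open MeasureTheory ProbabilityTheory Filter Topology Asymptotics

noncomputable section

/-- A discounted infinite-horizon Markov decision process with state space `S`, action space `A`,
discount factor `γ ∈ (0, 1)`, transition probabilities `P(· | s, a)` and random rewards: `R s a` is
the law, on `[0, ∞)`, of the reward collected when action `a` is taken in state `s`. -/
structure FiniteMDP (S A : Type*) where
  γ : ℝ
  γ_pos : 0 < γ
  γ_lt_one : γ < 1
  P : S → A → PMF S
  R : S → A → Measure ℝ
  R_prob : ∀ s a, IsProbabilityMeasure (R s a)
  R_nonneg : ∀ s a, ∀ᵐ x ∂(R s a), 0 ≤ x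

namespace FiniteMDP

/-- A (possibly randomized) stationary policy: `π s` is the law of the action taken in state `s`. -/
abbrev Policy (S A : Type*) := S → PMF A

/-- `π` is greedy for `Q`: in every state it only plays maximizers of `Q (s, ·)`. Ties may be broken
in any way, deterministically or at random. -/
def IsGreedy {S A : Type*} (π : Policy S A) (Q : S × A → ℝ) : Prop :=
  ∀ s, ∀ a ∈ (π s).support, ∀ a', Q (s, a') ≤ Q (s, a)

/-- The greedy value `max_a Q (s, a)`. -/
def greedyValue {S A : Type*} [Fintype A] [Nonempty A] (Q : S × A → ℝ) (s : S) : ℝ :=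
  Finset.univ.sup' Finset.univ_nonempty fun a => Q (s, a)

section Values

variable {S A : Type*} (M : FiniteMDP S A)

/-- The expected reward `r(s, a) = E R(s, a)`. -/
def meanReward (x : S × A) : ℝ := ∫ y, y ∂(M.R x.1 x.2)

/-- One step of the state-action chain under the policy `π`: from `(s, a)` the next state is
`s' ∼ P(· | s, a)`, and the next action is `a' ∼ π(· | s')`. -/
def stepPMF (π : Policy S A) (x : S × A) : PMF (S × A) :=
  (M.P x.1 x.2).bind fun s' => (π s').map fun a' => (s', a')

variable [Fintype S] [MeasurableSpace S] [DiscreteMeasurableSpace S]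
  [Fintype A] [MeasurableSpace A] [DiscreteMeasurableSpace A]

/-- The Markov kernel of the state-action chain. -/
def stepKernel (π : Policy S A) : Kernel (S × A) (S × A) :=
  Kernel.ofFunOfCountable fun x => (M.stepPMF π x).toMeasure

instance (π : Policy S A) : IsMarkovKernel (M.stepKernel π) :=
  ⟨fun x => inferInstanceAs (IsProbabilityMeasure (M.stepPMF π x).toMeasure)⟩

/-- The same kernel, reading the current state-action pair off the history up to time `n`. -/
def historyKernel (π : Policy S A) (n : ℕ) :
    Kernel ((i : Finset.Iic n) → (fun _ : ℕ => S × A) i) (S × A) :=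
  (M.stepKernel π).comap (fun h => h ⟨n, Finset.mem_Iic.2 le_rfl⟩) (measurable_pi_apply _)

instance (π : Policy S A) (n : ℕ) : IsMarkovKernel (M.historyKernel π n) := by
  unfold historyKernel; infer_instance

/-- The law of the trajectory `(s_t, a_t)_{t ≥ 0}` induced by `π` and started at
`(s_0, a_0) = x`. -/
def trajLaw (π : Policy S A) (x : S × A) : Measure (ℕ → S × A) :=
  Kernel.traj (X := fun _ : ℕ => S × A) (M.historyKernel π) 0 fun _ => x

/-- The Q-function of `π`: `Q^π(s, a) = E_π [∑_t γ^t r(s_t, a_t) | s_0 = s, a_0 = a]`. -/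
def policyQ (π : Policy S A) (x : S × A) : ℝ :=
  ∫ τ, ∑' t : ℕ, M.γ ^ t * M.meanReward (τ t) ∂(M.trajLaw π x)

/-- The value function `V^π(s) = ∑_a π(a | s) Q^π(s, a)`. -/
def policyV (π : Policy S A) (s : S) : ℝ :=
  ∑ a, (π s a).toReal * M.policyQ π (s, a)

/-- The optimal Q-function `Q^*(s, a) = max_π Q^π(s, a)`. -/
def optQ (x : S × A) : ℝ := ⨆ π : Policy S A, M.policyQ π x

/-- `π` is an optimal policy: it attains `V^*(s) = max_π V^π(s)` in every state `s`. -/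
def IsOptimal (π : Policy S A) : Prop :=
  ∀ (π' : Policy S A) (s : S), M.policyV π' s ≤ M.policyV π s

end Values

section Matrices

variable {S A : Type*} [Fintype S] [DecidableEq S] (M : FiniteMDP S A)

/-- The transition matrix `P`, whose `(s, a)`-th row is `P(· | s, a)`. -/
def transMatrix : Matrix (S × A) S ℝ :=
  Matrix.of fun x s' => (M.P x.1 x.2 s').toReal

/-- The projection matrix `Π^π = diag(π(· | 1)ᵀ, …, π(· | S)ᵀ)`. -/
def projMatrix (π : Policy S A) : Matrix S (S × A) ℝ :=
  Matrix.of fun s y => if y.1 = s then (π s y.2).toReal else 0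

/-- The state-action transition matrix `P^π = P Π^π`. -/
def policyMatrix (π : Policy S A) : Matrix (S × A) (S × A) ℝ :=
  M.transMatrix * projMatrix π

end Matrices

section Learning

variable {S A : Type*} [Fintype A] [Nonempty A] (M : FiniteMDP S A)

/-- The empirical Bellman operator built from one sample `(r(s, a), s'(s, a))` for every
state-action pair: `Q ↦ r(s, a) + γ max_{a'} Q(s'(s, a), a')`. -/
def empBellman (ζ : S × A → ℝ × S) (Q : S × A → ℝ) (x : S × A) : ℝ :=
  (ζ x).1 + M.γ * greedyValue Q (ζ x).2

/-- Synchronous Q-learning with step sizes `η`, initial point `Q₀` and samples `ζ t` collected in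
iteration `t ≥ 1`. -/
def qIter (η : ℕ → ℝ) (Q₀ : S × A → ℝ) (ζ : ℕ → S × A → ℝ × S) : ℕ → S × A → ℝ
  | 0 => Q₀
  | t + 1 => (1 - η (t + 1)) • qIter η Q₀ ζ t
      + η (t + 1) • M.empBellman (ζ (t + 1)) (qIter η Q₀ ζ t)

/-- The averaged iterate `(1 / T) ∑_{t=1}^T Q_t`. -/
def qAvg (η : ℕ → ℝ) (Q₀ : S × A → ℝ) (ζ : ℕ → S × A → ℝ × S) (T : ℕ) : S × A → ℝ :=
  (1 / (T : ℝ)) • ∑ t ∈ Finset.Icc 1 T, M.qIter η Q₀ ζ t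

variable [Fintype S]

/-- The Bellman operator `(𝒯 Q)(s, a) = r(s, a) + γ E_{s' ∼ P(· | s, a)} max_{a'} Q(s', a')`. -/
def bellman (Q : S × A → ℝ) (x : S × A) : ℝ :=
  M.meanReward x + M.γ * ∑ s', (M.P x.1 x.2 s').toReal * greedyValue Q s'

variable [MeasurableSpace S]

/-- The law of the samples of one iteration of the generative model: for every `(s, a)`, a reward
with law `R(s, a)` and a next state with law `P(· | s, a)`, all of them independent. -/
def sampleLaw : Measure (S × A → ℝ × S) :=
  Measure.pi fun x => (M.R x.1 x.2).prod (M.P x.1 x.2).toMeasure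

variable [DiscreteMeasurableSpace S] [MeasurableSpace A] [DiscreteMeasurableSpace A]

/-- The Bellman noise `Z(s, a) = (𝒯̂ Q^*)(s, a) - (𝒯 Q^*)(s, a)` of a sample. -/
def bellmanNoise (ζ : S × A → ℝ × S) (x : S × A) : ℝ :=
  M.empBellman ζ M.optQ x - M.bellman M.optQ x

/-- The covariance matrix `Var(Z) = E Z Zᵀ` of the Bellman noise. -/
def noiseCov : Matrix (S × A) (S × A) ℝ :=
  Matrix.of fun x y => ∫ ζ, M.bellmanNoise ζ x * M.bellmanNoise ζ y ∂M.sampleLaw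

/-- `Var_Q = (I - γ P^π)⁻¹ Var(Z) (I - γ P^π)⁻ᵀ`. -/
def asympVar [DecidableEq S] [DecidableEq A] (π : Policy S A) : Matrix (S × A) (S × A) ℝ :=
  (1 - M.γ • M.policyMatrix π)⁻¹ * M.noiseCov *
    ((1 - M.γ • M.policyMatrix π)⁻¹).transpose

end Learning

end FiniteMDP

/-- The step-size condition on `(η_t)_{t ≥ 0}`. -/
structure StepSizeCondition (η : ℕ → ℝ) : Prop where
  pos : ∀ t, 0 < η t
  le_one : ∀ t, η t ≤ 1
  antitone : Antitone η
  tendsto_zero : Tendsto η atTop (𝓝 0)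
  mul_monotone : Monotone fun t : ℕ => (t : ℝ) * η t
  mul_tendsto : Tendsto (fun t : ℕ => (t : ℝ) * η t) atTop atTop
  ratio : (fun t : ℕ => (η t - η (t + 1)) / η t) =o[atTop] η
  sum_sqrt : Tendsto (fun T : ℕ => (1 / √(T : ℝ)) * ∑ t ∈ Finset.range (T + 1), η t) atTop (𝓝 0)
  sum_le : ∃ C : ℝ, ∀ T : ℕ, 1 ≤ T → (∑ t ∈ Finset.range (T + 1), η t) / ((T : ℝ) * η T) ≤ C

end

/-!
# Asymptotic normality of averaged Q-learning

**The optimal Q-function.** Integrating along the trajectory gives the policy evaluation equation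
`Q^π = r + γ P^π Q^π` (`policyQ_eq`). Comparing it with the fixed point of the Bellman operator by
means of a minimum principle for `I - γ P^π` (`nonneg_of_policyStep_le`) identifies that fixed point
with `Q^*` (`bellman_optQ`), and shows that an optimal policy `π^*` only mixes maximizers of `Q^*`
(`IsOptimal.sum_eq_greedyValue`). The same minimum principle makes `I - γ P^{π^*}` invertible.

**Rate of convergence.** Let `Δ_t = Q_t - Q^*` and let `N_t` be the recursive average of the Bellman
noise with the same step sizes. For every realization the empirical Bellman operators are
`γ`-contractions in the sup norm, so `‖Δ_t - N_t‖` satisfies a scalar contractive recursion driven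
by `‖N_{t-1}‖` (`norm_sub_noiseIter_succ_le`). Each coordinate of `N_t` is a weighted sum of
independent centered variables. A supersolution argument for such recursions
(`StepSizeCondition.exists_le_mul_of_recursion`) then gives `E ‖Δ_t‖² = O(η_t)`, first for `N_t` and
then for `Δ_t` (`IsSampleSequence.exists_integral_sq_norm_qIter_sub_le`).

**Linearization.** With `V_Q = max_a Q(·, a)`, the inequality
`P^{π^*} (Q - Q^*) ≤ P (V_Q - V^*) ≤ P^{π_Q} (Q - Q^*)` and the Lipschitz condition bound the
linearization error at `Q^*` by `L ‖Q - Q^*‖²` (`abs_greedyError_le`). Solving the recursion for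
`(I - γ P^{π^*}) Δ_t` and summing over `t`, as Polyak and Juditsky do, writes
`√T (Q̄_T - Q^*)` as `T^{-1/2} (I - γ P^{π^*})⁻¹ ∑ Z_t` plus a remainder
(`exists_norm_qAvg_sub_le`). The remainder has three sources, and each tends to `0` in `L¹`
(`IsSampleSequence.tendsto_integral_averagingRemainder`):

* `∑ (Δ_t - Δ_{t+1}) / η_{t+1}`, which after summation by parts is `O(η_T^{-1/2})` in mean, while
  `T η_T → ∞`;
* the fluctuation of the sampled next states, a sum of orthogonal increments with variances at
  most of order `η_t` (`integral_sq_sum_mul_le`);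
* the linearization errors, of order `∑ η_t` in mean, which is `o(√T)`.

**Conclusion.** The multivariate central limit theorem applies to the i.i.d. vectors
`(I - γ P^{π^*})⁻¹ Z_t`; it is reduced to the one-dimensional theorem by characteristic functions
(`tendstoInDistribution_multivariateGaussian`). Slutsky's theorem discards the remainder.
-/

/-! ### Averages over a finitely supported law -/

section PMFSum

variable {α : Type*} [Fintype α] (p : PMF α)

theorem PMF.sum_toReal_eq_one : ∑ a, (p a).toReal = 1 := by
  have h := p.tsum_coe
  rw [tsum_fintype] at h
  rw [← ENNReal.toReal_sum fun a _ => p.apply_ne_top a, h, ENNReal.toReal_one]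

theorem PMF.sum_toReal_mul_mono {f g : α → ℝ} (h : ∀ a, f a ≤ g a) :
    ∑ a, (p a).toReal * f a ≤ ∑ a, (p a).toReal * g a :=
  Finset.sum_le_sum fun a _ => mul_le_mul_of_nonneg_left (h a) ENNReal.toReal_nonneg

theorem PMF.sum_toReal_mul_const (c : ℝ) : ∑ a, (p a).toReal * c = c := by
  rw [← Finset.sum_mul, p.sum_toReal_eq_one, one_mul]

theorem PMF.sum_toReal_mul_le {f : α → ℝ} {c : ℝ} (h : ∀ a, f a ≤ c) :
    ∑ a, (p a).toReal * f a ≤ c :=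
  (p.sum_toReal_mul_mono h).trans_eq (p.sum_toReal_mul_const c)

theorem PMF.le_sum_toReal_mul {f : α → ℝ} {c : ℝ} (h : ∀ a, c ≤ f a) :
    c ≤ ∑ a, (p a).toReal * f a :=
  (p.sum_toReal_mul_const c).symm.trans_le (p.sum_toReal_mul_mono h)

theorem PMF.abs_sum_toReal_mul_le {f : α → ℝ} {c : ℝ} (h : ∀ a, |f a| ≤ c) :
    |∑ a, (p a).toReal * f a| ≤ c :=
  abs_le.2 ⟨p.le_sum_toReal_mul fun a => (abs_le.1 (h a)).1,
    p.sum_toReal_mul_le fun a => (abs_le.1 (h a)).2⟩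

theorem PMF.sum_toReal_mul_eq_of_support {f : α → ℝ} {c : ℝ} (h : ∀ a ∈ p.support, f a = c) :
    ∑ a, (p a).toReal * f a = c := by
  rw [← p.sum_toReal_mul_const c]
  refine Finset.sum_congr rfl fun a _ => ?_
  by_cases ha : a ∈ p.support
  · rw [h a ha]
  · rw [(PMF.apply_eq_zero_iff p a).2 ha]; simp

end PMFSum

namespace FiniteMDP

/-! ### The greedy value -/

section Greedy

variable {S A : Type*} [Fintype A] [Nonempty A]

theorem le_greedyValue (Q : S × A → ℝ) (s : S) (a : A) : Q (s, a) ≤ greedyValue Q s :=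
  Finset.le_sup' (fun a => Q (s, a)) (Finset.mem_univ a)

theorem greedyValue_le {Q : S × A → ℝ} {s : S} {c : ℝ} (h : ∀ a, Q (s, a) ≤ c) :
    greedyValue Q s ≤ c :=
  Finset.sup'_le _ _ fun a _ => h a

theorem exists_eq_greedyValue (Q : S × A → ℝ) (s : S) : ∃ a, Q (s, a) = greedyValue Q s := by
  obtain ⟨a, -, ha⟩ :=
    Finset.exists_mem_eq_sup' (Finset.univ_nonempty (α := A)) (fun a => Q (s, a))
  exact ⟨a, ha.symm⟩

theorem IsGreedy.sum_eq_greedyValue {π : Policy S A} {Q : S × A → ℝ} (h : IsGreedy π Q) (s : S) :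
    ∑ a, (π s a).toReal * Q (s, a) = greedyValue Q s :=
  (π s).sum_toReal_mul_eq_of_support fun a ha =>
    le_antisymm (le_greedyValue Q s a) (greedyValue_le (h s a ha))

theorem sum_le_greedyValue (π : Policy S A) (Q : S × A → ℝ) (s : S) :
    ∑ a, (π s a).toReal * Q (s, a) ≤ greedyValue Q s :=
  (π s).sum_toReal_mul_le (le_greedyValue Q s)

theorem exists_isGreedy (Q : S × A → ℝ) : ∃ π : Policy S A, IsGreedy π Q := by
  choose a ha using exists_eq_greedyValue Q
  refine ⟨fun s => PMF.pure (a s), fun s b hb a' => ?_⟩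
  rw [PMF.support_pure, Set.mem_singleton_iff] at hb
  rw [hb, ha]
  exact le_greedyValue Q s a'

variable [Fintype S]

theorem abs_greedyValue_sub_le (Q Q' : S × A → ℝ) (s : S) :
    |greedyValue Q s - greedyValue Q' s| ≤ ‖Q - Q'‖ := by
  have key : ∀ Q Q' : S × A → ℝ, greedyValue Q s - greedyValue Q' s ≤ ‖Q - Q'‖ := by
    intro Q Q'
    rw [sub_le_iff_le_add]
    refine greedyValue_le fun a => ?_
    have h1 := (Real.le_norm_self _).trans (norm_le_pi_norm (Q - Q') (s, a))
    have h2 := le_greedyValue Q' s a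
    simp only [Pi.sub_apply] at h1
    linarith
  refine abs_le.2 ⟨?_, key Q Q'⟩
  have := key Q' Q
  rw [norm_sub_rev] at this
  linarith

end Greedy

/-! ### The state-action chain and the policy evaluation equation -/

section Evaluation

variable {S A : Type*} [Fintype S] [Fintype A] (M : FiniteMDP S A)

/-- The expectation of `v (s', a')` when `s' ∼ P(· | x)` and `a' ∼ π(· | s')`: the action of `P^π`
on functions. -/
noncomputable def policyStep (π : Policy S A) (v : S × A → ℝ) (x : S × A) : ℝ :=
  ∑ s', (M.P x.1 x.2 s').toReal * ∑ a, (π s' a).toReal * v (s', a)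

theorem policyMatrix_mulVec [DecidableEq S] (π : Policy S A) (v : S × A → ℝ) :
    (M.policyMatrix π).mulVec v = M.policyStep π v := by
  ext x
  rw [policyMatrix, ← Matrix.mulVec_mulVec]
  simp only [Matrix.mulVec, dotProduct, transMatrix, projMatrix, Matrix.of_apply, policyStep]
  refine Finset.sum_congr rfl fun s' _ => ?_
  congr 1
  rw [Fintype.sum_prod_type, Finset.sum_eq_single s']
  · simp
  · intro b _ hb
    simp [hb]
  · simp

theorem abs_policyStep_le (π : Policy S A) (v : S × A → ℝ) (x : S × A) :
    |M.policyStep π v x| ≤ ‖v‖ :=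
  (M.P x.1 x.2).abs_sum_toReal_mul_le fun s' => (π s').abs_sum_toReal_mul_le fun a =>
    norm_le_pi_norm v (s', a)

theorem policyStep_sub (π : Policy S A) (v w : S × A → ℝ) (x : S × A) :
    M.policyStep π (v - w) x = M.policyStep π v x - M.policyStep π w x := by
  simp only [policyStep, Pi.sub_apply, mul_sub, Finset.sum_sub_distrib]

/-- A function dominating its discounted one-step expectation is nonnegative. -/
theorem nonneg_of_policyStep_le (π : Policy S A) {w : S × A → ℝ}
    (h : ∀ x, M.γ * M.policyStep π w x ≤ w x) (x : S × A) : 0 ≤ w x := by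
  have : Nonempty (S × A) := ⟨x⟩
  obtain ⟨y, hy⟩ := Finite.exists_min w
  have h1 : w y ≤ M.policyStep π w y :=
    PMF.le_sum_toReal_mul _ fun s' => PMF.le_sum_toReal_mul _ fun a => hy (s', a)
  have h2 := h y
  have h3 := mul_le_mul_of_nonneg_left h1 M.γ_pos.le
  have h4 : 0 ≤ w y := by nlinarith [M.γ_lt_one]
  exact h4.trans (hy x)

theorem isUnit_one_sub_policyMatrix [DecidableEq S] [DecidableEq A] (π : Policy S A) :
    IsUnit (1 - M.γ • M.policyMatrix π) := by
  refine Matrix.mulVec_injective_iff_isUnit.1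
    ((injective_iff_map_eq_zero (Matrix.mulVecLin (1 - M.γ • M.policyMatrix π))).2 fun v hv => ?_)
  rw [Matrix.mulVecLin_apply, Matrix.sub_mulVec, Matrix.one_mulVec, Matrix.smul_mulVec,
    policyMatrix_mulVec, sub_eq_zero] at hv
  have hv' : ∀ x, v x = M.γ * M.policyStep π v x := fun x => congrFun hv x
  have hneg : ∀ x, M.policyStep π (-v) x = -M.policyStep π v x := fun x => by
    simp [policyStep]
  ext x
  refine le_antisymm ?_ (M.nonneg_of_policyStep_le π (fun x => (hv' x).ge) x)
  have := M.nonneg_of_policyStep_le π (w := -v) (fun x => by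
    rw [hneg, Pi.neg_apply, hv' x]; linarith) x
  simpa using this

theorem norm_iterate_policyStep_le (π : Policy S A) (f : S × A → ℝ) (t : ℕ) :
    ‖(M.policyStep π)^[t] f‖ ≤ ‖f‖ := by
  induction t with
  | zero => rfl
  | succ t ih =>
    rw [Function.iterate_succ_apply']
    exact ((pi_norm_le_iff_of_nonneg (norm_nonneg _)).2 (M.abs_policyStep_le π _)).trans ih

theorem summable_pow_mul_iterate (π : Policy S A) (f : S × A → ℝ) (x : S × A) :
    Summable fun t => M.γ ^ t * (M.policyStep π)^[t] f x := by
  refine Summable.of_norm_bounded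
    ((summable_geometric_of_lt_one M.γ_pos.le M.γ_lt_one).mul_right ‖f‖) fun t => ?_
  rw [norm_mul, Real.norm_of_nonneg (pow_nonneg M.γ_pos.le t)]
  exact mul_le_mul_of_nonneg_left
    ((norm_le_pi_norm _ x).trans (M.norm_iterate_policyStep_le π f t)) (pow_nonneg M.γ_pos.le t)

variable [MeasurableSpace S] [DiscreteMeasurableSpace S]
  [MeasurableSpace A] [DiscreteMeasurableSpace A]

theorem integral_stepKernel (π : Policy S A) (f : S × A → ℝ) (x : S × A) :
    ∫ y, f y ∂M.stepKernel π x = M.policyStep π f x := by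
  classical
  change ∫ y, f y ∂(M.stepPMF π x).toMeasure = _
  rw [PMF.integral_eq_sum, Fintype.sum_prod_type, policyStep]
  refine Finset.sum_congr rfl fun s' _ => ?_
  rw [Finset.mul_sum]
  refine Finset.sum_congr rfl fun a _ => ?_
  have : M.stepPMF π x (s', a) = M.P x.1 x.2 s' * π s' a := by
    rw [stepPMF, PMF.bind_apply, tsum_eq_single s']
    · rw [PMF.map_apply, tsum_eq_single a]
      · simp
      · intro b hb; simp [Ne.symm hb]
    · intro b hb
      rw [PMF.map_apply]
      simp [Ne.symm hb]
  rw [this, ENNReal.toReal_mul, smul_eq_mul, mul_assoc]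

instance (π : Policy S A) (x : S × A) : IsProbabilityMeasure (M.trajLaw π x) := by
  unfold trajLaw; infer_instance

theorem integrable_trajLaw (π : Policy S A) (x : S × A) (f : S × A → ℝ) (t : ℕ) :
    Integrable (fun τ => f (τ t)) (M.trajLaw π x) := by
  refine Integrable.of_bound (C := ‖f‖) ?_ (ae_of_all _ fun τ => norm_le_pi_norm f _)
  exact ((measurable_of_countable f).comp (measurable_pi_apply t)).aestronglyMeasurable

theorem integral_trajLaw_zero (π : Policy S A) (x : S × A) (f : S × A → ℝ) :
    ∫ τ, f (τ 0) ∂M.trajLaw π x = f x := by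
  have hm : Measurable (Preorder.frestrictLe (π := fun _ : ℕ => S × A) 0) := by fun_prop
  have h : (M.trajLaw π x).map (Preorder.frestrictLe (π := fun _ : ℕ => S × A) 0)
      = Measure.dirac fun _ => x := by
    rw [trajLaw, Kernel.traj_map_frestrictLe_apply, Kernel.partialTraj_self, Kernel.id_apply]
  have h2 : ∫ y, f (y ⟨0, Finset.mem_Iic.2 le_rfl⟩)
      ∂(M.trajLaw π x).map (Preorder.frestrictLe (π := fun _ : ℕ => S × A) 0) = f x := by
    rw [h, integral_dirac]
  rw [integral_map hm.aemeasurable] at h2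
  · exact h2
  · exact ((measurable_of_countable f).comp (measurable_pi_apply _)).aestronglyMeasurable

/-- The Markov property of the trajectory, in expectation. -/
theorem integral_trajLaw_succ (π : Policy S A) (x : S × A) (f : S × A → ℝ) (t : ℕ) :
    ∫ τ, f (τ (t + 1)) ∂M.trajLaw π x = ∫ τ, M.policyStep π f (τ t) ∂M.trajLaw π x := by
  have hm : Measurable (Preorder.frestrictLe (π := fun _ : ℕ => S × A) t) := by fun_prop
  have hf : Measurable f := measurable_of_countable f
  have hstep : ∀ h : (i : Finset.Iic t) → (fun _ : ℕ => S × A) i,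
      ∫ τ, f (τ (t + 1)) ∂Kernel.traj (X := fun _ : ℕ => S × A) (M.historyKernel π) t h
        = M.policyStep π f (h ⟨t, Finset.mem_Iic.2 le_rfl⟩) := by
    intro h
    rw [← integral_stepKernel]
    have h1 := congrArg (fun κ => κ h)
      (Kernel.map_traj_succ_self (X := fun _ : ℕ => S × A) (κ := M.historyKernel π) (a := t))
    simp only [historyKernel, Kernel.comap_apply] at h1
    rw [← h1, Kernel.map_apply _ (measurable_pi_apply _),
      integral_map (measurable_pi_apply _).aemeasurable hf.aestronglyMeasurable]
  have h1 := Kernel.integral_traj_partialTraj (X := fun _ : ℕ => S × A) (κ := M.historyKernel π)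
    (Nat.zero_le t) (M.integrable_trajLaw π x f (t + 1))
  rw [trajLaw, ← h1]
  simp only [hstep]
  rw [← Kernel.traj_map_frestrictLe_apply, integral_map hm.aemeasurable]
  · rfl
  · have hg : Measurable (M.policyStep π f) := measurable_of_countable _
    exact (hg.comp (measurable_pi_apply
      (⟨t, Finset.mem_Iic.2 le_rfl⟩ : Finset.Iic t))).aestronglyMeasurable

theorem integral_trajLaw_eq_iterate (π : Policy S A) (f : S × A → ℝ) (t : ℕ) (x : S × A) :
    ∫ τ, f (τ t) ∂M.trajLaw π x = (M.policyStep π)^[t] f x := by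
  induction t generalizing f with
  | zero => exact M.integral_trajLaw_zero π x f
  | succ t ih => rw [integral_trajLaw_succ, ih, Function.iterate_succ_apply]

/-- `Q^π` is the Neumann series of `(I - γ P^π)⁻¹ r`. -/
theorem policyQ_eq_tsum (π : Policy S A) (x : S × A) :
    M.policyQ π x = ∑' t : ℕ, M.γ ^ t * (M.policyStep π)^[t] M.meanReward x := by
  rw [policyQ, ← integral_tsum_of_summable_integral_norm]
  · exact tsum_congr fun t => by rw [integral_const_mul, integral_trajLaw_eq_iterate]
  · exact fun t => (M.integrable_trajLaw π x M.meanReward t).const_mul _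
  · refine Summable.of_nonneg_of_le (fun t => integral_nonneg fun τ => norm_nonneg _) (fun t => ?_)
      ((summable_geometric_of_lt_one M.γ_pos.le M.γ_lt_one).mul_right ‖M.meanReward‖)
    have h : ∀ τ : ℕ → S × A, ‖M.γ ^ t * M.meanReward (τ t)‖ ≤ M.γ ^ t * ‖M.meanReward‖ := by
      intro τ
      rw [norm_mul, Real.norm_of_nonneg (pow_nonneg M.γ_pos.le t)]
      exact mul_le_mul_of_nonneg_left (norm_le_pi_norm _ _) (pow_nonneg M.γ_pos.le t)
    calc _ ≤ ∫ _, M.γ ^ t * ‖M.meanReward‖ ∂M.trajLaw π x :=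
          integral_mono ((M.integrable_trajLaw π x M.meanReward t).const_mul _).norm
            (integrable_const _) h
      _ = _ := by simp

/-- The policy evaluation equation `Q^π = r + γ P^π Q^π`. -/
theorem policyQ_eq (π : Policy S A) (x : S × A) :
    M.policyQ π x = M.meanReward x + M.γ * M.policyStep π (M.policyQ π) x := by
  rw [policyQ_eq_tsum, (M.summable_pow_mul_iterate π _ x).tsum_eq_zero_add]
  simp only [pow_zero, one_mul, Function.iterate_zero, id_eq, Function.iterate_succ_apply']
  congr 1
  have h : ∀ y, HasSum (fun t => M.γ ^ t * (M.policyStep π)^[t] M.meanReward y) (M.policyQ π y) :=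
    fun y => by
      rw [policyQ_eq_tsum]; exact (M.summable_pow_mul_iterate π _ y).hasSum
  have h2 : HasSum (fun t => ∑ s', (M.P x.1 x.2 s').toReal * ∑ a, (π s' a).toReal *
      (M.γ ^ t * (M.policyStep π)^[t] M.meanReward (s', a))) (M.policyStep π (M.policyQ π) x) :=
    hasSum_sum fun s' _ => (hasSum_sum fun a _ => (h (s', a)).mul_left _).mul_left _
  rw [← (h2.mul_left M.γ).tsum_eq]
  refine tsum_congr fun t => ?_
  rw [policyStep, pow_succ, Finset.mul_sum, Finset.mul_sum]
  refine Finset.sum_congr rfl fun s' _ => ?_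
  simp only [Finset.mul_sum]
  exact Finset.sum_congr rfl fun a _ => by ring

end Evaluation

/-! ### The Bellman optimality equation -/

section Optimality

variable {S A : Type*} [Fintype S] [Fintype A] [Nonempty A] (M : FiniteMDP S A)

theorem exists_bellman_fixedPoint : ∃ q : S × A → ℝ, M.bellman q = q := by
  have hc : ContractingWith ⟨M.γ, M.γ_pos.le⟩ M.bellman := by
    refine ⟨M.γ_lt_one, LipschitzWith.of_dist_le_mul fun Q Q' => ?_⟩
    rw [dist_eq_norm, dist_eq_norm]
    refine (pi_norm_le_iff_of_nonneg (mul_nonneg M.γ_pos.le (norm_nonneg _))).2 fun x => ?_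
    have : (M.bellman Q - M.bellman Q') x = M.γ * ∑ s', (M.P x.1 x.2 s').toReal *
        (greedyValue Q s' - greedyValue Q' s') := by
      simp only [Pi.sub_apply, bellman, mul_sub, Finset.sum_sub_distrib]
      ring
    rw [this, norm_mul, Real.norm_of_nonneg M.γ_pos.le]
    exact mul_le_mul_of_nonneg_left
      (PMF.abs_sum_toReal_mul_le _ fun s' => abs_greedyValue_sub_le Q Q' s') M.γ_pos.le
  obtain ⟨q, hq, -⟩ := hc.exists_fixedPoint 0 (edist_ne_top _ _)
  exact ⟨q, hq⟩

theorem policyStep_le_greedy (π : Policy S A) (q : S × A → ℝ) (x : S × A) :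
    M.policyStep π q x ≤ ∑ s', (M.P x.1 x.2 s').toReal * greedyValue q s' :=
  PMF.sum_toReal_mul_mono _ fun s' => sum_le_greedyValue π q s'

theorem IsGreedy.policyStep_eq {π : Policy S A} {q : S × A → ℝ} (h : IsGreedy π q) (x : S × A) :
    M.policyStep π q x = ∑ s', (M.P x.1 x.2 s').toReal * greedyValue q s' := by
  simp only [policyStep, h.sum_eq_greedyValue]

variable [MeasurableSpace S] [DiscreteMeasurableSpace S]
  [MeasurableSpace A] [DiscreteMeasurableSpace A]

theorem policyQ_le_of_fixedPoint {q : S × A → ℝ} (hq : M.bellman q = q) (π : Policy S A)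
    (x : S × A) : M.policyQ π x ≤ q x := by
  rw [← sub_nonneg]
  refine M.nonneg_of_policyStep_le π (w := q - M.policyQ π) (fun x => ?_) x
  have h1 := congrFun hq x
  have h2 := M.policyQ_eq π x
  have h3 := mul_le_mul_of_nonneg_left (M.policyStep_le_greedy π q x) M.γ_pos.le
  rw [policyStep_sub, Pi.sub_apply]
  simp only [bellman] at h1
  linarith

theorem IsGreedy.policyQ_eq_of_fixedPoint {q : S × A → ℝ} (hq : M.bellman q = q) {π : Policy S A}
    (hπ : IsGreedy π q) (x : S × A) : M.policyQ π x = q x := by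
  refine le_antisymm (M.policyQ_le_of_fixedPoint hq π x) ?_
  rw [← sub_nonneg]
  refine M.nonneg_of_policyStep_le π (w := M.policyQ π - q) (fun x => ?_) x
  have h1 := congrFun hq x
  have h2 := M.policyQ_eq π x
  rw [policyStep_sub, Pi.sub_apply, hπ.policyStep_eq]
  simp only [bellman] at h1
  linarith

theorem optQ_eq_of_fixedPoint {q : S × A → ℝ} (hq : M.bellman q = q) : M.optQ = q := by
  obtain ⟨π, hπ⟩ := exists_isGreedy q
  ext x
  have : Nonempty (Policy S A) := ⟨π⟩
  refine le_antisymm (ciSup_le fun π' => M.policyQ_le_of_fixedPoint hq π' x) ?_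
  rw [← hπ.policyQ_eq_of_fixedPoint M hq x]
  exact le_ciSup (f := fun π => M.policyQ π x)
    ⟨q x, by rintro _ ⟨π', rfl⟩; exact M.policyQ_le_of_fixedPoint hq π' x⟩ π

/-- The Bellman optimality equation `𝒯 Q^* = Q^*`. -/
theorem bellman_optQ : M.bellman M.optQ = M.optQ := by
  obtain ⟨q, hq⟩ := M.exists_bellman_fixedPoint
  rwa [M.optQ_eq_of_fixedPoint hq]

/-- An optimal policy only mixes maximizers of `Q^*`. -/
theorem IsOptimal.sum_eq_greedyValue {π : Policy S A} (hπ : M.IsOptimal π) (s : S) :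
    ∑ a, (π s a).toReal * M.optQ (s, a) = greedyValue M.optQ s := by
  refine le_antisymm (sum_le_greedyValue π _ s) ?_
  obtain ⟨π', hπ'⟩ := exists_isGreedy M.optQ
  have h1 : M.policyV π' s = greedyValue M.optQ s := by
    simp only [policyV, hπ'.policyQ_eq_of_fixedPoint M M.bellman_optQ, hπ'.sum_eq_greedyValue]
  rw [← h1]
  exact (hπ π' s).trans
    ((π s).sum_toReal_mul_mono fun a => M.policyQ_le_of_fixedPoint M.bellman_optQ π (s, a))

/-- The linearization error `P (V_Q - V^*) - P^{π^*} (Q - Q^*)` of the greedy value at `Q^*`, where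
`V_Q = max_a Q(·, a)`. -/
noncomputable def greedyError (π : Policy S A) (Q : S × A → ℝ) (x : S × A) : ℝ :=
  ∑ s', (M.P x.1 x.2 s').toReal * (greedyValue Q s' - greedyValue M.optQ s')
    - M.policyStep π (Q - M.optQ) x

/-- The linearization error is squeezed between `0` and `(P^{π_Q} - P^{π^*}) (Q - Q^*)`, for any
greedy policy `π_Q`: the maximum of `Q` dominates its `π^*`-average, and the maximum of `Q^*`
dominates its `π_Q`-average. -/
theorem abs_greedyError_le [DecidableEq S] {π πQ : Policy S A} (hπ : M.IsOptimal π)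
    {Q : S × A → ℝ} (hQ : IsGreedy πQ Q) (x : S × A) :
    |M.greedyError π Q x|
      ≤ ‖(M.policyMatrix πQ - M.policyMatrix π).mulVec (Q - M.optQ)‖ := by
  have e1 : M.policyStep π M.optQ x
      = ∑ s', (M.P x.1 x.2 s').toReal * greedyValue M.optQ s' := by
    simp only [policyStep, hπ.sum_eq_greedyValue]
  have e2 := hQ.policyStep_eq M x
  have h1 := M.policyStep_le_greedy π Q x
  have h2 := M.policyStep_le_greedy πQ M.optQ x
  have h3 : M.policyStep πQ (Q - M.optQ) x - M.policyStep π (Q - M.optQ) x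
      ≤ ‖(M.policyMatrix πQ - M.policyMatrix π).mulVec (Q - M.optQ)‖ := by
    refine le_trans (le_of_eq ?_) ((Real.le_norm_self _).trans (norm_le_pi_norm
      ((M.policyMatrix πQ - M.policyMatrix π).mulVec (Q - M.optQ)) x))
    rw [Matrix.sub_mulVec, policyMatrix_mulVec, policyMatrix_mulVec, Pi.sub_apply]
  have e3 : M.greedyError π Q x = ∑ s', (M.P x.1 x.2 s').toReal * greedyValue Q s'
      - ∑ s', (M.P x.1 x.2 s').toReal * greedyValue M.optQ s'
      - M.policyStep π (Q - M.optQ) x := by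
    simp only [greedyError, mul_sub, Finset.sum_sub_distrib]
  rw [policyStep_sub, policyStep_sub] at h3
  rw [policyStep_sub] at e3
  rw [abs_le]
  constructor <;> linarith

end Optimality

end FiniteMDP

/-! ### Step sizes -/

namespace StepSizeCondition

variable {η : ℕ → ℝ}

theorem le_two_mul_succ (hη : StepSizeCondition η) {t : ℕ} (ht : 1 ≤ t) : η t ≤ 2 * η (t + 1) := by
  have h := hη.mul_monotone (Nat.le_succ t)
  simp only [Nat.succ_eq_add_one, Nat.cast_add, Nat.cast_one] at h
  have ht' : (1 : ℝ) ≤ t := by exact_mod_cast ht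
  have h1 := hη.pos (t + 1)
  have h2 : (t : ℝ) * η t ≤ t * (2 * η (t + 1)) := by nlinarith
  exact le_of_mul_le_mul_left h2 (by linarith)

theorem exists_le_mul_succ (hη : StepSizeCondition η) :
    ∃ κ : ℝ, 1 ≤ κ ∧ ∀ t, η t ≤ κ * η (t + 1) := by
  have h01 := div_nonneg (hη.pos 0).le (hη.pos 1).le
  refine ⟨2 + η 0 / η 1, by linarith, fun t => ?_⟩
  rcases Nat.eq_zero_or_pos t with rfl | ht
  · have h := div_mul_cancel₀ (η 0) (hη.pos 1).ne'
    rw [zero_add, add_mul, h]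
    linarith [hη.pos 1]
  · have h := mul_nonneg h01 (hη.pos (t + 1)).le
    rw [add_mul]
    linarith [hη.le_two_mul_succ ht]

/-- A scalar recursion contracting at rate `c η_t`, with a perturbation of order `η_t ^ 2`, is
`O(η_t)`: the condition `(η_t - η_{t+1}) / η_t = o(η_t)` lets `B η_t` be a supersolution for
large `B`. -/
theorem exists_le_mul_of_recursion (hη : StepSizeCondition η) {w : ℕ → ℝ} {c K : ℝ}
    (hc : 0 < c) (hc1 : c ≤ 1)
    (hw : ∀ t, w (t + 1) ≤ (1 - c * η (t + 1)) * w t + K * (η t * η (t + 1))) :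
    ∃ B : ℝ, 0 ≤ B ∧ ∀ t, w t ≤ B * η t := by
  obtain ⟨t₀, ht₀⟩ := eventually_atTop.1 (hη.ratio.def (show 0 < c / 4 by linarith))
  set n := t₀ + 1
  -- the sum bounds `w t / η t` for `t ≤ n`, and `2 |K| / c` makes the induction step work
  set B := ∑ t ∈ Finset.range (n + 1), |w t| / η t + 2 * |K| / c
  have hsum : ∀ t ∈ Finset.range (n + 1), 0 ≤ |w t| / η t := fun t _ =>
    div_nonneg (abs_nonneg _) (hη.pos t).le
  have hK : 0 ≤ 2 * |K| / c := by positivity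
  have hB : 0 ≤ B := add_nonneg (Finset.sum_nonneg hsum) hK
  have hBK : 2 * |K| ≤ c * B := by
    have h1 : 2 * |K| / c ≤ B := le_add_of_nonneg_left (Finset.sum_nonneg hsum)
    rw [div_le_iff₀ hc] at h1
    linarith
  have hsmall : ∀ t ≤ n, w t ≤ B * η t := by
    intro t ht
    rw [← div_le_iff₀ (hη.pos t)]
    have h1 := Finset.single_le_sum hsum (Finset.mem_range_succ_iff.2 ht)
    have h2 : w t / η t ≤ |w t| / η t := div_le_div_of_nonneg_right (le_abs_self _) (hη.pos t).le
    linarith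
  refine ⟨B, hB, fun t => ?_⟩
  rcases le_total t n with ht | ht
  · exact hsmall t ht
  induction t, ht using Nat.le_induction with
  | base => exact hsmall n le_rfl
  | succ t ht ih =>
    have p := hη.pos t
    have p' := hη.pos (t + 1)
    have h1 := ht₀ t (by omega)
    rw [Real.norm_of_nonneg (div_nonneg (sub_nonneg.2 (hη.antitone (Nat.le_succ t))) p.le),
      Real.norm_of_nonneg p.le, div_le_iff₀ p] at h1
    have h2 := hη.le_two_mul_succ (t := t) (by omega)
    have h3 : 0 ≤ 1 - c * η (t + 1) := by nlinarith [hη.le_one (t + 1)]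
    have h4 := mul_le_mul_of_nonneg_left ih h3
    -- `η_t ≤ 2 η_{t+1}` turns `η_t - η_{t+1} ≤ (c / 4) η_t ^ 2` into half of the contraction rate
    have h5 : B * (η t - η (t + 1)) ≤ B * (c / 2 * (η t * η (t + 1))) := by
      refine mul_le_mul_of_nonneg_left (h1.trans ?_) hB
      have := mul_le_mul_of_nonneg_left h2 (show 0 ≤ c / 4 * η t by positivity)
      linarith
    have h6 : K * (η t * η (t + 1)) ≤ c * B / 2 * (η t * η (t + 1)) :=
      mul_le_mul_of_nonneg_right (by linarith [le_abs_self K]) (mul_pos p p').le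
    linarith [hw t]

theorem tendsto_one_div_sqrt_mul_one_div_sqrt (hη : StepSizeCondition η) :
    Tendsto (fun T : ℕ => 1 / √(T : ℝ) * (1 / √(η T))) atTop (𝓝 0) := by
  have h : Tendsto (fun T : ℕ => (√((T : ℝ) * η T))⁻¹) atTop (𝓝 0) :=
    tendsto_inv_atTop_zero.comp (Real.tendsto_sqrt_atTop.comp hη.mul_tendsto)
  refine h.congr fun T => ?_
  rw [Real.sqrt_mul (Nat.cast_nonneg T)]
  simp [mul_comm]

theorem tendsto_one_div_sqrt_mul_sum (hη : StepSizeCondition η) :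
    Tendsto (fun T : ℕ => 1 / √(T : ℝ) * ∑ t ∈ Finset.range T, η t) atTop (𝓝 0) := by
  refine squeeze_zero (fun T => ?_) (fun T => ?_) hη.sum_sqrt
  · exact mul_nonneg (by positivity) (Finset.sum_nonneg fun t _ => (hη.pos t).le)
  · rw [Finset.sum_range_succ]
    exact mul_le_mul_of_nonneg_left (by linarith [hη.pos T]) (by positivity)

theorem tendsto_one_div_mul_sum (hη : StepSizeCondition η) :
    Tendsto (fun T : ℕ => 1 / (T : ℝ) * ∑ t ∈ Finset.range T, η t) atTop (𝓝 0) := by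
  have h0 : Tendsto (fun T : ℕ => 1 / √(T : ℝ)) atTop (𝓝 0) := by
    simp only [one_div]
    exact tendsto_inv_atTop_zero.comp (Real.tendsto_sqrt_atTop.comp tendsto_natCast_atTop_atTop)
  have h := h0.mul hη.tendsto_one_div_sqrt_mul_sum
  rw [zero_mul] at h
  refine h.congr fun T => ?_
  rw [← mul_assoc, div_mul_div_comm, one_mul, Real.mul_self_sqrt (Nat.cast_nonneg T)]

/-- With `a_t = η_t^{-1/2}` the summand is at most a constant times `a_{t+1} - a_t`, so the sum
telescopes. -/
theorem exists_sum_sqrt_mul_le (hη : StepSizeCondition η) : ∃ C : ℝ, 0 ≤ C ∧ ∀ T : ℕ,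
    ∑ t ∈ Finset.range T, √(η t) * (1 / η (t + 1) - 1 / η t) ≤ C * (1 / √(η T)) := by
  obtain ⟨κ, hκ, h⟩ := hη.exists_le_mul_succ
  refine ⟨κ + 1, by linarith, fun T => ?_⟩
  have hterm : ∀ t, √(η t) * (1 / η (t + 1) - 1 / η t)
      ≤ (κ + 1) * (1 / √(η (t + 1)) - 1 / √(η t)) := by
    intro t
    have p := Real.sqrt_pos.2 (hη.pos t)
    have p' := Real.sqrt_pos.2 (hη.pos (t + 1))
    have e := Real.sq_sqrt (hη.pos t).le
    have e' := Real.sq_sqrt (hη.pos (t + 1)).le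
    have hle : √(η (t + 1)) ≤ √(η t) := Real.sqrt_le_sqrt (hη.antitone (Nat.le_succ t))
    have hge : √(η t) ≤ κ * √(η (t + 1)) := by
      refine Real.sqrt_le_iff.2 ⟨by positivity, ?_⟩
      rw [mul_pow, e']
      nlinarith [h t, hη.pos (t + 1)]
    generalize √(η t) = a at *
    generalize √(η (t + 1)) = b at *
    rw [← e, ← e']
    have h1 : a * (1 / b ^ 2 - 1 / a ^ 2) = (a / b + 1) * (1 / b - 1 / a) := by
      field_simp
      ring
    rw [h1]
    refine mul_le_mul_of_nonneg_right ?_ (sub_nonneg.2 (one_div_le_one_div_of_le p' hle))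
    have : a / b ≤ κ := (div_le_iff₀ p').2 hge
    linarith
  refine (Finset.sum_le_sum fun t _ => hterm t).trans ?_
  rw [← Finset.mul_sum, Finset.sum_range_sub (fun t => 1 / √(η t))]
  refine mul_le_mul_of_nonneg_left ?_ (by linarith)
  have : 0 ≤ 1 / √(η 0) := by positivity
  linarith

/-- Summation by parts for the increments of a sequence, weighted by the inverse step sizes. -/
theorem sum_inv_smul_sub {E : Type*} [AddCommGroup E] [Module ℝ E] (η : ℕ → ℝ) (Δ : ℕ → E)
    (T : ℕ) : ∑ t ∈ Finset.range T, (1 / η (t + 1)) • (Δ t - Δ (t + 1))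
      = ∑ t ∈ Finset.range T, (1 / η (t + 1) - 1 / η t) • Δ t
        + ((1 / η 0) • Δ 0 - (1 / η T) • Δ T) := by
  induction T with
  | zero => simp
  | succ T ih =>
    rw [Finset.sum_range_succ, Finset.sum_range_succ, ih]
    module

end StepSizeCondition

/-! ### Second moments of sums with independent increments -/

section Orthogonality

variable {Ω : Type*} [MeasurableSpace Ω] {μ : Measure Ω}

theorem integral_sq_add_mul_of_indepFun {U W : Ω → ℝ} (hU : MemLp U 2 μ) (hW : MemLp W 2 μ)
    (h : IndepFun U W μ) (h0 : ∫ ω, W ω ∂μ = 0) (a b : ℝ) :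
    ∫ ω, (a * U ω + b * W ω) ^ 2 ∂μ = a ^ 2 * ∫ ω, U ω ^ 2 ∂μ + b ^ 2 * ∫ ω, W ω ^ 2 ∂μ := by
  have hUW : ∫ ω, U ω * W ω ∂μ = 0 := by
    rw [h.integral_fun_mul_eq_mul_integral hU.1 hW.1, h0, mul_zero]
  have i1 := (hU.integrable_sq).const_mul (a ^ 2)
  have i2 := (hW.integrable_sq).const_mul (b ^ 2)
  have i3 := (hU.integrable_mul hW).const_mul (2 * a * b)
  simp only [Pi.mul_apply] at i3
  have e : ∀ ω, (a * U ω + b * W ω) ^ 2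
      = a ^ 2 * U ω ^ 2 + b ^ 2 * W ω ^ 2 + 2 * a * b * (U ω * W ω) := fun ω => by ring
  simp only [e]
  rw [integral_add (i1.fun_add i2) i3, integral_add i1 i2, integral_const_mul, integral_const_mul,
    integral_const_mul, hUW, mul_zero, add_zero]

/-- The increments `X_t B_t` are orthogonal, because `B_t` is centered and independent of the
past. -/
theorem integral_sq_sum_mul_le {X B : ℕ → Ω → ℝ} (hX : ∀ t, MemLp (X t) 2 μ)
    (hBm : ∀ t, AEStronglyMeasurable (B t) μ) (hB : ∀ t ω, |B t ω| ≤ 1)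
    (hB0 : ∀ t, ∫ ω, B t ω ∂μ = 0)
    (hind : ∀ T, IndepFun (fun ω => (∑ t ∈ Finset.range T, X t ω * B t ω, X T ω)) (B T) μ)
    (T : ℕ) :
    ∫ ω, (∑ t ∈ Finset.range T, X t ω * B t ω) ^ 2 ∂μ
      ≤ ∑ t ∈ Finset.range T, ∫ ω, X t ω ^ 2 ∂μ := by
  have hXB : ∀ t, MemLp (fun ω => X t ω * B t ω) 2 μ := fun t =>
    (hX t).mono ((hX t).1.mul (hBm t)) (ae_of_all _ fun ω => by
      rw [norm_mul]
      exact mul_le_of_le_one_right (norm_nonneg _) (hB t ω))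
  have hS : ∀ T, MemLp (fun ω => ∑ t ∈ Finset.range T, X t ω * B t ω) 2 μ := fun T =>
    memLp_finsetSum _ fun t _ => hXB t
  induction T with
  | zero => simp
  | succ T ih =>
    have hm : Measurable fun p : ℝ × ℝ => p.1 * p.2 := by fun_prop
    have hi : IndepFun (fun ω => (∑ t ∈ Finset.range T, X t ω * B t ω) * X T ω) (B T) μ :=
      (hind T).comp hm measurable_id
    have hcross : ∫ ω, (∑ t ∈ Finset.range T, X t ω * B t ω) * (X T ω * B T ω) ∂μ = 0 := by
      simp only [← mul_assoc]
      rw [hi.integral_fun_mul_eq_mul_integral ((hS T).1.mul (hX T).1) (hBm T), hB0, mul_zero]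
    have i1 := (hS T).integrable_sq
    have i2 := (hXB T).integrable_sq
    have i3 := ((hS T).integrable_mul (hXB T)).const_mul 2
    simp only [Pi.mul_apply] at i3
    have e : ∀ ω, (∑ t ∈ Finset.range (T + 1), X t ω * B t ω) ^ 2
        = (∑ t ∈ Finset.range T, X t ω * B t ω) ^ 2 + (X T ω * B T ω) ^ 2
          + 2 * ((∑ t ∈ Finset.range T, X t ω * B t ω) * (X T ω * B T ω)) := fun ω => by
      rw [Finset.sum_range_succ]; ring
    simp only [e]
    rw [integral_add (i1.fun_add i2) i3, integral_add i1 i2, integral_const_mul, hcross, mul_zero,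
      add_zero, Finset.sum_range_succ]
    refine add_le_add ih (integral_mono i2 (hX T).integrable_sq fun ω => ?_)
    simp only [mul_pow]
    exact mul_le_of_le_one_right (sq_nonneg _) (by
      rw [← sq_abs]; exact pow_le_one₀ (abs_nonneg _) (hB T ω))

theorem integral_abs_le_sqrt [IsProbabilityMeasure μ] {f : Ω → ℝ} (hf : MemLp f 2 μ) :
    ∫ ω, |f ω| ∂μ ≤ √(∫ ω, f ω ^ 2 ∂μ) := by
  refine Real.le_sqrt_of_sq_le ?_
  have h := variance_nonneg (fun ω => |f ω|) μ
  rw [variance_eq_sub (by exact hf.norm)] at h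
  have e : ∫ ω, ((fun ω => |f ω|) ^ 2) ω ∂μ = ∫ ω, f ω ^ 2 ∂μ := by
    simp
  rw [e] at h
  linarith

end Orthogonality

/-! ### The multivariate central limit theorem -/

section CLT

open scoped RealInnerProductSpace

/-- The central limit theorem for i.i.d. centered random vectors: by Lévy's theorem it suffices to
treat the characteristic function at each `u`, that is, the real random variables `⟪W k, u⟫`. -/
theorem tendstoInDistribution_multivariateGaussian {Ω ι : Type*} [MeasurableSpace Ω]
    {μ : Measure Ω} [IsProbabilityMeasure μ] [Fintype ι] [DecidableEq ι]
    {W : ℕ → Ω → EuclideanSpace ℝ ι} (hindep : iIndepFun W μ)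
    (hident : ∀ i, IdentDistrib (W i) (W 0) μ μ) (hmem : MemLp (W 0) 2 μ)
    (h0 : ∀ u, ∫ ω, ⟪W 0 ω, u⟫ ∂μ = 0) {V : Matrix ι ι ℝ} (hV : V.PosSemidef)
    (hcov : ∀ u : EuclideanSpace ℝ ι,
      ∫ ω, ⟪W 0 ω, u⟫ ^ 2 ∂μ = u.ofLp ⬝ᵥ V.mulVec u.ofLp) :
    TendstoInDistribution (fun (n : ℕ) ω => (√(n : ℝ))⁻¹ • ∑ k ∈ Finset.range n, W k ω)
      atTop (id : EuclideanSpace ℝ ι → EuclideanSpace ℝ ι)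
      (fun _ => μ) (multivariateGaussian 0 V) where
  forall_aemeasurable n :=
    (Finset.aemeasurable_fun_sum _ fun k _ => (hident k).aemeasurable_fst).fun_const_smul _
  aemeasurable_limit := aemeasurable_id
  tendsto := by
    have hWm : ∀ k, AEMeasurable (W k) μ := fun k => (hident k).aemeasurable_fst
    have hsm : ∀ n : ℕ, AEMeasurable (fun ω => (√(n : ℝ))⁻¹ • ∑ k ∈ Finset.range n, W k ω) μ :=
      fun n => (Finset.aemeasurable_fun_sum _ fun k _ => hWm k).fun_const_smul _
    refine ProbabilityMeasure.tendsto_iff_tendsto_charFun.2 fun u => ?_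
    have hum : Measurable fun w : EuclideanSpace ℝ ι => ⟪w, u⟫ := by fun_prop
    have hX0 : MemLp (fun ω => ⟪W 0 ω, u⟫) 2 μ := hmem.inner_const u
    have hvar : Var[fun ω => ⟪W 0 ω, u⟫; μ] = u.ofLp ⬝ᵥ V.mulVec u.ofLp := by
      rw [variance_of_integral_eq_zero hX0.1.aemeasurable (h0 u), hcov u]
    -- the one-dimensional limit theorem for `⟪W k, u⟫`, whose characteristic function at `1` is the
    -- characteristic function of the vector at `u`
    have key := tendstoInDistribution_inv_sqrt_mul_sum_sub
      (X := fun k ω => ⟪W k ω, u⟫) (P := μ)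
      (P' := gaussianReal 0 (Var[fun ω => ⟪W 0 ω, u⟫; μ]).toNNReal) (Y := id)
      HasLaw.id hX0 (hindep.comp (fun _ w => ⟪w, u⟫) fun _ => hum)
      (fun i => (hident i).comp hum)
    have key2 := (ProbabilityMeasure.tendsto_iff_tendsto_charFun.1 key.tendsto) 1
    simp only [ProbabilityMeasure.coe_mk, Measure.map_id] at key2 ⊢
    rw [charFun_multivariateGaussian hV]
    rw [charFun_gaussianReal, hvar] at key2
    have hlim : Complex.exp (⟪u, (0 : EuclideanSpace ℝ ι)⟫ * Complex.I
          - (u.ofLp ⬝ᵥ V.mulVec u.ofLp : ℝ) / 2)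
        = Complex.exp ((1 : ℝ) * (0 : ℝ) * Complex.I
          - ((u.ofLp ⬝ᵥ V.mulVec u.ofLp).toNNReal : ℝ) * (1 : ℝ) ^ 2 / 2) := by
      have h : 0 ≤ u.ofLp ⬝ᵥ V.mulVec u.ofLp := by
        rw [← hcov u]; exact integral_nonneg fun ω => sq_nonneg _
      rw [Real.coe_toNNReal _ h]
      simp
    rw [hlim]
    refine key2.congr fun n => ?_
    have hsm1 : AEMeasurable (fun ω => (√(n : ℝ))⁻¹ *
        (∑ k ∈ Finset.range n, ⟪W k ω, u⟫ - n * ∫ ω, ⟪W 0 ω, u⟫ ∂μ)) μ :=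
      key.forall_aemeasurable n
    rw [charFun_apply, charFun_apply, integral_map hsm1 (by fun_prop),
      integral_map (hsm n) (by fun_prop)]
    refine integral_congr_ae (ae_of_all _ fun ω => ?_)
    simp only [h0 u, mul_zero, sub_zero, real_inner_smul_left, sum_inner]
    simp

end CLT

namespace FiniteMDP

/-! ### Pathwise analysis of Q-learning -/

theorem exists_norm_mulVec_le {ι : Type*} [Fintype ι] (B : Matrix ι ι ℝ) :
    ∃ K : ℝ, 0 ≤ K ∧ ∀ v, ‖B.mulVec v‖ ≤ K * ‖v‖ :=
  ⟨‖B.mulVecLin.toContinuousLinearMap‖, norm_nonneg _,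
    fun v => B.mulVecLin.toContinuousLinearMap.le_opNorm v⟩

section NextState

variable {S A : Type*} (M : FiniteMDP S A)

/-- The centered indicator `1{s' = s} - P(s | x)` of the sampled next state `s'` at `x`. -/
noncomputable def nextStateDev (z : S × A → ℝ × S) (x : S × A) (s : S) : ℝ :=
  Set.indicator {s} 1 (z x).2 - (M.P x.1 x.2 s).toReal

theorem abs_nextStateDev_le (z : S × A → ℝ × S) (x : S × A) (s : S) :
    |M.nextStateDev z x s| ≤ 1 := by
  have h0 : 0 ≤ (M.P x.1 x.2 s).toReal := ENNReal.toReal_nonneg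
  have h1 : (M.P x.1 x.2 s).toReal ≤ 1 :=
    ENNReal.toReal_le_of_le_ofReal zero_le_one (by simpa using PMF.coe_le_one _ _)
  have h2 : 0 ≤ Set.indicator {s} (1 : S → ℝ) (z x).2 :=
    Set.indicator_nonneg (fun _ _ => zero_le_one) _
  have h3 : Set.indicator {s} (1 : S → ℝ) (z x).2 ≤ 1 :=
    Set.indicator_le_self' (fun _ _ => zero_le_one) _
  rw [nextStateDev, abs_le]
  constructor <;> linarith

variable [Fintype S]

theorem sum_nextStateDev_mul (z : S × A → ℝ × S) (x : S × A) (h : S → ℝ) :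
    ∑ s, h s * M.nextStateDev z x s = h (z x).2 - ∑ s, (M.P x.1 x.2 s).toReal * h s := by
  classical
  simp only [nextStateDev, mul_sub, Finset.sum_sub_distrib]
  congr 1
  · rw [Finset.sum_eq_single (z x).2]
    · simp
    · intro b _ hb
      simp [Ne.symm hb]
    · simp
  · exact Finset.sum_congr rfl fun s _ => mul_comm _ _

end NextState

section Pathwise

variable {S A : Type*} [Fintype S] [Fintype A] [Nonempty A] (M : FiniteMDP S A)

theorem norm_empBellman_sub_le (z : S × A → ℝ × S) (Q Q' : S × A → ℝ) :
    ‖M.empBellman z Q - M.empBellman z Q'‖ ≤ M.γ * ‖Q - Q'‖ := by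
  refine (pi_norm_le_iff_of_nonneg (mul_nonneg M.γ_pos.le (norm_nonneg _))).2 fun x => ?_
  rw [Pi.sub_apply, empBellman, empBellman, add_sub_add_left_eq_sub, ← mul_sub, norm_mul,
    Real.norm_of_nonneg M.γ_pos.le]
  exact mul_le_mul_of_nonneg_left (abs_greedyValue_sub_le Q Q' _) M.γ_pos.le

variable [MeasurableSpace S] [DiscreteMeasurableSpace S]
  [MeasurableSpace A] [DiscreteMeasurableSpace A]

/-- The stochastic approximation `N_{t+1} = (1 - η_{t+1}) N_t + η_{t+1} Z_{t+1}` of the mean of the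
Bellman noise, started at `N_0 = 0`. -/
noncomputable def noiseIter (η : ℕ → ℝ) (ζ : ℕ → S × A → ℝ × S) : ℕ → S × A → ℝ
  | 0 => 0
  | t + 1 => (1 - η (t + 1)) • noiseIter η ζ t + η (t + 1) • M.bellmanNoise (ζ (t + 1))

theorem bellmanNoise_eq (z : S × A → ℝ × S) :
    M.bellmanNoise z = M.empBellman z M.optQ - M.optQ := by
  ext x
  rw [bellmanNoise, bellman_optQ, Pi.sub_apply]

theorem qIter_succ_sub_optQ (η : ℕ → ℝ) (Q₀ : S × A → ℝ) (ζ : ℕ → S × A → ℝ × S) (t : ℕ) :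
    M.qIter η Q₀ ζ (t + 1) - M.optQ = (1 - η (t + 1)) • (M.qIter η Q₀ ζ t - M.optQ)
      + η (t + 1) • (M.empBellman (ζ (t + 1)) (M.qIter η Q₀ ζ t)
        - M.empBellman (ζ (t + 1)) M.optQ + M.bellmanNoise (ζ (t + 1))) := by
  rw [qIter, bellmanNoise_eq]
  module

/-- Once the linear process `noiseIter` is subtracted, the error obeys a scalar recursion, because
the empirical Bellman operators are `γ`-contractions in the sup norm for every realization. -/
theorem norm_sub_noiseIter_succ_le {η : ℕ → ℝ} (h0 : ∀ t, 0 ≤ η t) (h1 : ∀ t, η t ≤ 1)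
    (Q₀ : S × A → ℝ) (ζ : ℕ → S × A → ℝ × S) (t : ℕ) :
    ‖M.qIter η Q₀ ζ (t + 1) - M.optQ - M.noiseIter η ζ (t + 1)‖
      ≤ (1 - (1 - M.γ) * η (t + 1)) * ‖M.qIter η Q₀ ζ t - M.optQ - M.noiseIter η ζ t‖
        + η (t + 1) * M.γ * ‖M.noiseIter η ζ t‖ := by
  have e : M.qIter η Q₀ ζ (t + 1) - M.optQ - M.noiseIter η ζ (t + 1)
      = (1 - η (t + 1)) • (M.qIter η Q₀ ζ t - M.optQ - M.noiseIter η ζ t)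
        + η (t + 1) • (M.empBellman (ζ (t + 1)) (M.qIter η Q₀ ζ t)
          - M.empBellman (ζ (t + 1)) M.optQ) := by
    rw [qIter_succ_sub_optQ, noiseIter]
    module
  have b1 := M.norm_empBellman_sub_le (ζ (t + 1)) (M.qIter η Q₀ ζ t) M.optQ
  have b2 : ‖M.qIter η Q₀ ζ t - M.optQ‖
      ≤ ‖M.qIter η Q₀ ζ t - M.optQ - M.noiseIter η ζ t‖ + ‖M.noiseIter η ζ t‖ := by
    simpa using norm_add_le (M.qIter η Q₀ ζ t - M.optQ - M.noiseIter η ζ t) (M.noiseIter η ζ t)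
  rw [e]
  refine (norm_add_le _ _).trans ?_
  rw [norm_smul, norm_smul, Real.norm_of_nonneg (sub_nonneg.2 (h1 _)), Real.norm_of_nonneg (h0 _)]
  have b3 := mul_le_mul_of_nonneg_left
    (b1.trans (mul_le_mul_of_nonneg_left b2 M.γ_pos.le)) (h0 (t + 1))
  linarith

/-- The squared form keeps the rate `(1 - γ) η`, so that expectations can be taken. -/
theorem sq_norm_sub_noiseIter_succ_le {η : ℕ → ℝ} (h0 : ∀ t, 0 ≤ η t) (h1 : ∀ t, η t ≤ 1)
    (Q₀ : S × A → ℝ) (ζ : ℕ → S × A → ℝ × S) (t : ℕ) :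
    ‖M.qIter η Q₀ ζ (t + 1) - M.optQ - M.noiseIter η ζ (t + 1)‖ ^ 2
      ≤ (1 - (1 - M.γ) * η (t + 1)) * ‖M.qIter η Q₀ ζ t - M.optQ - M.noiseIter η ζ t‖ ^ 2
        + η (t + 1) * (M.γ ^ 2 / (1 - M.γ)) * ‖M.noiseIter η ζ t‖ ^ 2 := by
  have h := M.norm_sub_noiseIter_succ_le h0 h1 Q₀ ζ t
  have hc : 0 < 1 - M.γ := sub_pos.2 M.γ_lt_one
  have hc1 : 1 - M.γ ≤ 1 := by linarith [M.γ_pos]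
  refine (pow_le_pow_left₀ (norm_nonneg _) h 2).trans ?_
  generalize ‖M.qIter η Q₀ ζ t - M.optQ - M.noiseIter η ζ t‖ = d
  generalize ‖M.noiseIter η ζ t‖ = n
  -- convexity of the square, for the weights `1 - (1 - γ) η` and `(1 - γ) η`
  set c := 1 - M.γ
  have p0 : 0 ≤ c * η (t + 1) := mul_nonneg hc.le (h0 _)
  have p1 : 0 ≤ 1 - c * η (t + 1) := sub_nonneg.2 (mul_le_one₀ hc1 (h0 _) (h1 _))
  have e1 : η (t + 1) * M.γ * n = c * η (t + 1) * (M.γ * n / c) := by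
    field_simp
  have e2 : η (t + 1) * (M.γ ^ 2 / c) * n ^ 2 = c * η (t + 1) * (M.γ * n / c) ^ 2 := by
    field_simp
  rw [e1, e2]
  nlinarith [mul_nonneg (mul_nonneg p0 p1) (sq_nonneg (d - M.γ * n / c))]

theorem norm_greedyError_le [DecidableEq S] {π : Policy S A} (hπ : M.IsOptimal π) {L : ℝ}
    {greedy : (S × A → ℝ) → Policy S A} (hgreedy : ∀ Q, IsGreedy (greedy Q) Q)
    (hL : ∀ Q : S × A → ℝ,
      ‖(M.policyMatrix (greedy Q) - M.policyMatrix π).mulVec (Q - M.optQ)‖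
        ≤ L * ‖Q - M.optQ‖ ^ 2) (Q : S × A → ℝ) :
    ‖M.greedyError π Q‖ ≤ |L| * ‖Q - M.optQ‖ ^ 2 :=
  (pi_norm_le_iff_of_nonneg (by positivity)).2 fun x =>
    (M.abs_greedyError_le hπ (hgreedy Q) x).trans
      ((hL Q).trans (mul_le_mul_of_nonneg_right (le_abs_self L) (sq_nonneg _)))

/-- A bound, up to a constant factor, for the error of the linear approximation of the scaled
average. The terms stem from the summation by parts of `(Q_t - Q_{t+1}) / η_{t+1}` (the first sum
and the two boundary terms), from the fluctuation of the sampled next states, and from the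
linearization of the greedy value. -/
noncomputable def averagingRemainder (η : ℕ → ℝ) (Q₀ : S × A → ℝ)
    (ζ : ℕ → S × A → ℝ × S) (T : ℕ) : ℝ :=
  1 / √(T : ℝ) * (∑ t ∈ Finset.range T, (1 / η (t + 1) - 1 / η t) * ‖M.qIter η Q₀ ζ t - M.optQ‖
    + 1 / η 0 * ‖M.qIter η Q₀ ζ 0 - M.optQ‖ + 1 / η T * ‖M.qIter η Q₀ ζ T - M.optQ‖
    + ∑ x, ∑ s, |∑ t ∈ Finset.range T, (greedyValue (M.qIter η Q₀ ζ t) s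
        - greedyValue M.optQ s) * M.nextStateDev (ζ (t + 1)) x s|
    + ∑ t ∈ Finset.range T, ‖M.qIter η Q₀ ζ t - M.optQ‖ ^ 2)

variable [DecidableEq S] [DecidableEq A]

/-- The recursion linearized at `Q^*`, solved for the drift `(I - γ P^{π^*}) (Q_t - Q^*)`. -/
theorem one_sub_policyMatrix_mulVec_sub_optQ (π : Policy S A) {η : ℕ → ℝ} (h0 : ∀ t, 0 < η t)
    (Q₀ : S × A → ℝ) (ζ : ℕ → S × A → ℝ × S) (t : ℕ) :
    (1 - M.γ • M.policyMatrix π).mulVec (M.qIter η Q₀ ζ t - M.optQ)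
      = (1 / η (t + 1)) • ((M.qIter η Q₀ ζ t - M.optQ) - (M.qIter η Q₀ ζ (t + 1) - M.optQ))
        + M.bellmanNoise (ζ (t + 1))
        + M.γ • (fun x => ∑ s, (greedyValue (M.qIter η Q₀ ζ t) s - greedyValue M.optQ s)
            * M.nextStateDev (ζ (t + 1)) x s)
        + M.γ • M.greedyError π (M.qIter η Q₀ ζ t) := by
  have hne := (h0 (t + 1)).ne'
  have e : M.empBellman (ζ (t + 1)) (M.qIter η Q₀ ζ t) - M.empBellman (ζ (t + 1)) M.optQ
      = M.γ • (fun x => ∑ s, (greedyValue (M.qIter η Q₀ ζ t) s - greedyValue M.optQ s)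
            * M.nextStateDev (ζ (t + 1)) x s)
        + M.γ • M.greedyError π (M.qIter η Q₀ ζ t)
        + M.γ • M.policyStep π (M.qIter η Q₀ ζ t - M.optQ) := by
    ext x
    simp only [Pi.sub_apply, Pi.add_apply, Pi.smul_apply, smul_eq_mul, empBellman, greedyError]
    rw [sum_nextStateDev_mul]
    ring
  rw [qIter_succ_sub_optQ, e, Matrix.sub_mulVec, Matrix.one_mulVec, Matrix.smul_mulVec,
    policyMatrix_mulVec]
  ext x
  simp only [Pi.sub_apply, Pi.add_apply, Pi.smul_apply, smul_eq_mul]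
  field_simp
  ring

/-- Polyak–Juditsky averaging: `√T (Q̄_T - Q^*)` is `T^{-1/2} ∑ (I - γ P^{π^*})⁻¹ Z_t` up to a
remainder, uniformly over the realizations of the samples. -/
theorem exists_norm_qAvg_sub_le {π : Policy S A} (hπ : M.IsOptimal π) {L : ℝ}
    {greedy : (S × A → ℝ) → Policy S A} (hgreedy : ∀ Q, IsGreedy (greedy Q) Q)
    (hL : ∀ Q : S × A → ℝ,
      ‖(M.policyMatrix (greedy Q) - M.policyMatrix π).mulVec (Q - M.optQ)‖
        ≤ L * ‖Q - M.optQ‖ ^ 2) {η : ℕ → ℝ} (hη : StepSizeCondition η) (Q₀ : S × A → ℝ) :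
    ∃ K : ℝ, 0 ≤ K ∧ ∀ (ζ : ℕ → S × A → ℝ × S) (T : ℕ),
      ‖√(T : ℝ) • (M.qAvg η Q₀ ζ T - M.optQ) - (√(T : ℝ))⁻¹ • ∑ t ∈ Finset.range T,
          (1 - M.γ • M.policyMatrix π)⁻¹.mulVec (M.bellmanNoise (ζ (t + 1)))‖
        ≤ K * M.averagingRemainder η Q₀ ζ T := by
  obtain ⟨K, hK, hKv⟩ := exists_norm_mulVec_le (1 - M.γ • M.policyMatrix π)⁻¹
  refine ⟨K * (1 + |L|) + 1, by positivity, fun ζ T => ?_⟩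
  set G := 1 - M.γ • M.policyMatrix π
  have hG : IsUnit G.det := (Matrix.isUnit_iff_isUnit_det G).1 (M.isUnit_one_sub_policyMatrix π)
  set Δ : ℕ → S × A → ℝ := fun t => M.qIter η Q₀ ζ t - M.optQ with hΔ
  set Y : ℕ → S × A → ℝ := fun t x => ∑ s, (greedyValue (M.qIter η Q₀ ζ t) s
    - greedyValue M.optQ s) * M.nextStateDev (ζ (t + 1)) x s with hY
  set E : ℕ → S × A → ℝ := fun t => M.greedyError π (M.qIter η Q₀ ζ t) with hE
  set Z : ℕ → S × A → ℝ := fun t => M.bellmanNoise (ζ (t + 1)) with hZ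
  have hstep : ∀ t, Δ t = G⁻¹.mulVec ((1 / η (t + 1)) • (Δ t - Δ (t + 1)) + M.γ • Y t + M.γ • E t)
      + G⁻¹.mulVec (Z t) := by
    intro t
    have h := M.one_sub_policyMatrix_mulVec_sub_optQ π hη.pos Q₀ ζ t
    have h2 := congrArg G⁻¹.mulVec h
    rw [Matrix.mulVec_mulVec, Matrix.nonsing_inv_mul G hG, Matrix.one_mulVec] at h2
    rw [← Matrix.mulVec_add]
    refine h2.trans (congrArg _ ?_)
    simp only [hΔ, hY, hE, hZ]
    abel
  set R : S × A → ℝ := ∑ t ∈ Finset.range T, (1 / η (t + 1)) • (Δ t - Δ (t + 1))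
    + M.γ • ∑ t ∈ Finset.range T, Y t + M.γ • ∑ t ∈ Finset.range T, E t with hR
  have hsum : ∑ t ∈ Finset.range T, Δ t
      = G⁻¹.mulVec R + ∑ t ∈ Finset.range T, G⁻¹.mulVec (Z t) := by
    rw [Finset.sum_congr rfl fun t _ => hstep t, Finset.sum_add_distrib]
    congr 1
    rw [hR, Finset.smul_sum, Finset.smul_sum, ← Finset.sum_add_distrib, ← Finset.sum_add_distrib]
    exact (map_sum (Matrix.mulVecLin G⁻¹) _ _).symm
  have havg : √(T : ℝ) • (M.qAvg η Q₀ ζ T - M.optQ)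
      = (√(T : ℝ))⁻¹ • (∑ t ∈ Finset.range T, Δ t + (Δ T - Δ 0)) := by
    have h1 : ∑ t ∈ Finset.range T, Δ t + (Δ T - Δ 0) = ∑ t ∈ Finset.range T, Δ (t + 1) := by
      rw [← Finset.sum_range_sub Δ T, ← Finset.sum_add_distrib]
      exact Finset.sum_congr rfl fun t _ => by abel
    have h2 : ∑ t ∈ Finset.Icc 1 T, M.qIter η Q₀ ζ t
        = ∑ t ∈ Finset.range T, M.qIter η Q₀ ζ (t + 1) := by
      rw [Finset.range_eq_Ico, Finset.sum_Ico_add' (fun t => M.qIter η Q₀ ζ t) 0 T 1]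
      rfl
    rw [h1, qAvg, h2]
    simp only [hΔ, Finset.sum_sub_distrib, Finset.sum_const, Finset.card_range, smul_sub,
      smul_smul, ← Nat.cast_smul_eq_nsmul ℝ]
    rw [mul_one_div, Real.sqrt_div_self', one_div, inv_mul_eq_div, Real.div_sqrt]
  have hdiff : √(T : ℝ) • (M.qAvg η Q₀ ζ T - M.optQ)
      - (√(T : ℝ))⁻¹ • ∑ t ∈ Finset.range T, G⁻¹.mulVec (Z t)
      = (√(T : ℝ))⁻¹ • (G⁻¹.mulVec R + (Δ T - Δ 0)) := by
    rw [havg, hsum]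
    module
  -- what remains is the triangle inequality, term by term
  rw [hdiff, norm_smul, Real.norm_of_nonneg (by positivity)]
  rw [averagingRemainder]
  set a1 := ∑ t ∈ Finset.range T, (1 / η (t + 1) - 1 / η t) * ‖Δ t‖ with ha1
  set a2 := 1 / η 0 * ‖Δ 0‖ with ha2
  set a3 := 1 / η T * ‖Δ T‖ with ha3
  set a4 := ∑ x, ∑ s, |∑ t ∈ Finset.range T, (greedyValue (M.qIter η Q₀ ζ t) s
                - greedyValue M.optQ s) * M.nextStateDev (ζ (t + 1)) x s| with ha4
  set a5 := ∑ t ∈ Finset.range T, ‖Δ t‖ ^ 2 with ha5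
  have hinv : ∀ t, 0 ≤ 1 / η (t + 1) - 1 / η t := fun t =>
    sub_nonneg.2 (one_div_le_one_div_of_le (hη.pos _) (hη.antitone (Nat.le_succ t)))
  have hge1 : ∀ t, 1 ≤ 1 / η t := fun t => (one_le_div₀ (hη.pos t)).2 (hη.le_one t)
  have p1 : 0 ≤ a1 := Finset.sum_nonneg fun t _ => mul_nonneg (hinv t) (norm_nonneg _)
  have p2 : ‖Δ 0‖ ≤ a2 := le_mul_of_one_le_left (norm_nonneg _) (hge1 0)
  have p3 : ‖Δ T‖ ≤ a3 := le_mul_of_one_le_left (norm_nonneg _) (hge1 T)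
  have p4 : 0 ≤ a4 := Finset.sum_nonneg fun x _ => Finset.sum_nonneg fun s _ => abs_nonneg _
  have p5 : 0 ≤ a5 := Finset.sum_nonneg fun t _ => sq_nonneg _
  have b1 : ‖∑ t ∈ Finset.range T, (1 / η (t + 1)) • (Δ t - Δ (t + 1))‖ ≤ a1 + (a2 + a3) := by
    rw [StepSizeCondition.sum_inv_smul_sub]
    refine (norm_add_le _ _).trans (add_le_add ((norm_sum_le _ _).trans
      (Finset.sum_le_sum fun t _ => ?_)) ((norm_sub_le _ _).trans (add_le_add ?_ ?_)))
    · rw [norm_smul, Real.norm_of_nonneg (hinv t)]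
    · rw [norm_smul, Real.norm_of_nonneg (zero_le_one.trans (hge1 0))]
    · rw [norm_smul, Real.norm_of_nonneg (zero_le_one.trans (hge1 T))]
  have b2 : ‖∑ t ∈ Finset.range T, Y t‖ ≤ a4 := by
    refine (pi_norm_le_iff_of_nonneg p4).2 fun x => ?_
    have : (∑ t ∈ Finset.range T, Y t) x = ∑ s, ∑ t ∈ Finset.range T,
        (greedyValue (M.qIter η Q₀ ζ t) s - greedyValue M.optQ s)
          * M.nextStateDev (ζ (t + 1)) x s := by
      rw [Finset.sum_apply, Finset.sum_comm]
    rw [this]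
    refine (norm_sum_le _ _).trans ?_
    exact Finset.single_le_sum (f := fun x => ∑ s, |∑ t ∈ Finset.range T,
      (greedyValue (M.qIter η Q₀ ζ t) s - greedyValue M.optQ s) * M.nextStateDev (ζ (t + 1)) x s|)
      (fun x _ => Finset.sum_nonneg fun s _ => abs_nonneg _) (Finset.mem_univ x)
  have b3 : ‖∑ t ∈ Finset.range T, E t‖ ≤ |L| * a5 := by
    rw [ha5, Finset.mul_sum]
    exact (norm_sum_le _ _).trans
      (Finset.sum_le_sum fun t _ => M.norm_greedyError_le hπ hgreedy hL _)
  have bR : ‖R‖ ≤ a1 + (a2 + a3) + a4 + |L| * a5 := by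
    refine (norm_add₃_le).trans (add_le_add (add_le_add b1 ?_) ?_)
    · rw [norm_smul, Real.norm_of_nonneg M.γ_pos.le]
      exact (mul_le_of_le_one_left (norm_nonneg _) M.γ_lt_one.le).trans b2
    · rw [norm_smul, Real.norm_of_nonneg M.γ_pos.le]
      exact (mul_le_of_le_one_left (norm_nonneg _) M.γ_lt_one.le).trans b3
  have q2 := (norm_nonneg (Δ 0)).trans p2
  have q3 := (norm_nonneg (Δ T)).trans p3
  have hL0 := abs_nonneg L
  have bR' : ‖R‖ ≤ (1 + |L|) * (a1 + a2 + a3 + a4 + a5) := by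
    have := mul_nonneg hL0 (show 0 ≤ a1 + a2 + a3 + a4 by positivity)
    nlinarith
  have hfin : ‖G⁻¹.mulVec R + (Δ T - Δ 0)‖
      ≤ (K * (1 + |L|) + 1) * (a1 + a2 + a3 + a4 + a5) := by
    have h1 := (hKv R).trans (mul_le_mul_of_nonneg_left bR' hK)
    have h2 := norm_add_le (G⁻¹.mulVec R) (Δ T - Δ 0)
    have h3 := norm_sub_le (Δ T) (Δ 0)
    linarith
  rw [one_div]
  refine (mul_le_mul_of_nonneg_left hfin (by positivity)).trans (le_of_eq ?_)
  ring

end Pathwise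

end FiniteMDP

namespace FiniteMDP

/-! ### The samples of the generative model -/

section Samples

variable {S A : Type*} (M : FiniteMDP S A)

instance (s : S) (a : A) : IsProbabilityMeasure (M.R s a) := M.R_prob s a

variable [Fintype S] [MeasurableSpace S] [Fintype A]

instance : IsProbabilityMeasure M.sampleLaw := by unfold sampleLaw; infer_instance

theorem measurePreserving_eval_sampleLaw (x : S × A) :
    MeasurePreserving (fun z : S × A → ℝ × S => z x) M.sampleLaw
      ((M.R x.1 x.2).prod (M.P x.1 x.2).toMeasure) :=
  measurePreserving_eval _ x

theorem measurePreserving_reward (x : S × A) :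
    MeasurePreserving (fun z : S × A → ℝ × S => (z x).1) M.sampleLaw (M.R x.1 x.2) :=
  measurePreserving_fst.comp (M.measurePreserving_eval_sampleLaw x)

theorem measurePreserving_nextState (x : S × A) :
    MeasurePreserving (fun z : S × A → ℝ × S => (z x).2) M.sampleLaw (M.P x.1 x.2).toMeasure :=
  measurePreserving_snd.comp (M.measurePreserving_eval_sampleLaw x)

theorem integral_reward (x : S × A) : ∫ z, (z x).1 ∂M.sampleLaw = M.meanReward x := by
  rw [meanReward, ← (M.measurePreserving_reward x).map_eq,
    integral_map (M.measurePreserving_reward x).aemeasurable (by fun_prop)]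

theorem memLp_reward (hR : ∀ s a, Integrable (fun x : ℝ => |x| ^ 4) (M.R s a)) (x : S × A) :
    MemLp (fun z : S × A → ℝ × S => (z x).1) 2 M.sampleLaw := by
  have h : MemLp (fun y : ℝ => y) 2 (M.R x.1 x.2) := by
    -- `y ^ 2 ≤ 1 + |y| ^ 4`
    rw [memLp_two_iff_integrable_sq measurable_id'.aestronglyMeasurable]
    refine ((integrable_const (1 : ℝ)).add (hR x.1 x.2)).mono'
      (measurable_id'.pow_const 2).aestronglyMeasurable (ae_of_all _ fun y => ?_)
    rw [Real.norm_of_nonneg (sq_nonneg y), Pi.add_apply, ← sq_abs]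
    nlinarith [sq_nonneg (|y| ^ 2 - 1), sq_nonneg |y|]
  exact h.comp_measurePreserving (M.measurePreserving_reward x)

variable [DiscreteMeasurableSpace S]

theorem integral_nextState (x : S × A) (f : S → ℝ) :
    ∫ z, f (z x).2 ∂M.sampleLaw = ∑ s, (M.P x.1 x.2 s).toReal * f s := by
  have h : ∫ s, f s ∂(M.P x.1 x.2).toMeasure = ∑ s, (M.P x.1 x.2 s).toReal * f s := by
    rw [PMF.integral_eq_sum]; rfl
  rw [← h, ← (M.measurePreserving_nextState x).map_eq,
    integral_map (M.measurePreserving_nextState x).aemeasurable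
      (measurable_of_countable f).aestronglyMeasurable]

theorem integrable_nextState (x : S × A) (f : S → ℝ) :
    Integrable (fun z : S × A → ℝ × S => f (z x).2) M.sampleLaw :=
  Integrable.of_bound ((measurable_of_countable f).comp
    (M.measurePreserving_nextState x).measurable).aestronglyMeasurable ‖f‖
    (ae_of_all _ fun _ => norm_le_pi_norm f _)

theorem measurable_nextStateDev (x : S × A) (s : S) :
    Measurable fun z : S × A → ℝ × S => M.nextStateDev z x s :=
  (measurable_of_countable fun s' : S => Set.indicator {s} (1 : S → ℝ) s'
    - (M.P x.1 x.2 s).toReal).comp (M.measurePreserving_nextState x).measurable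

theorem integral_nextStateDev (x : S × A) (s : S) :
    ∫ z, M.nextStateDev z x s ∂M.sampleLaw = 0 := by
  classical
  have h := M.integral_nextState x fun s' => Set.indicator {s} (1 : S → ℝ) s'
    - (M.P x.1 x.2 s).toReal
  refine h.trans ?_
  simp only [mul_sub, Finset.sum_sub_distrib, PMF.sum_toReal_mul_const]
  rw [Finset.sum_eq_single s]
  · simp
  · intro b _ hb
    simp [hb]
  · simp

variable [Nonempty A]

theorem measurable_greedyValue :
    Measurable fun p : (S × A → ℝ) × S => greedyValue p.1 p.2 := by
  refine measurable_from_prod_countable_left fun s => Continuous.measurable ?_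
  refine (LipschitzWith.of_dist_le_mul (K := 1) fun Q Q' => ?_).continuous
  rw [dist_eq_norm, dist_eq_norm, NNReal.coe_one, one_mul]
  exact abs_greedyValue_sub_le Q Q' s

theorem measurable_empBellman :
    Measurable fun p : (S × A → ℝ × S) × (S × A → ℝ) => M.empBellman p.1 p.2 := by
  refine measurable_pi_iff.2 fun x => ?_
  have h1 : Measurable fun p : (S × A → ℝ × S) × (S × A → ℝ) => (p.1 x) :=
    (measurable_pi_apply x).comp measurable_fst
  exact h1.fst.add (measurable_greedyValue.comp (measurable_snd.prodMk h1.snd) |>.const_mul M.γ)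

variable [MeasurableSpace A] [DiscreteMeasurableSpace A]

theorem measurable_bellmanNoise : Measurable M.bellmanNoise := by
  have h : Measurable fun z => M.empBellman z M.optQ :=
    M.measurable_empBellman.comp (measurable_id.prodMk measurable_const)
  refine measurable_pi_iff.2 fun x => ?_
  exact ((measurable_pi_apply x).comp h).sub_const _

theorem memLp_bellmanNoise (hR : ∀ s a, Integrable (fun x : ℝ => |x| ^ 4) (M.R s a)) (x : S × A) :
    MemLp (fun z => M.bellmanNoise z x) 2 M.sampleLaw := by
  have h : MemLp (fun z : S × A → ℝ × S => greedyValue M.optQ (z x).2) 2 M.sampleLaw := by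
    refine MemLp.of_bound ((measurable_of_countable (greedyValue M.optQ)).comp
      (M.measurePreserving_nextState x).measurable).aestronglyMeasurable
      ‖greedyValue M.optQ‖ (ae_of_all _ fun z => norm_le_pi_norm (greedyValue M.optQ) _)
  exact ((M.memLp_reward hR x).add (h.const_mul M.γ)).sub (memLp_const _)

theorem integral_bellmanNoise (hR : ∀ s a, Integrable (fun x : ℝ => |x| ^ 4) (M.R s a))
    (x : S × A) : ∫ z, M.bellmanNoise z x ∂M.sampleLaw = 0 := by
  have i1 := (M.memLp_reward hR x).integrable one_le_two
  have i2 := (M.integrable_nextState x (greedyValue M.optQ)).const_mul M.γ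
  simp only [bellmanNoise, empBellman]
  rw [integral_sub (i1.fun_add i2) (integrable_const _), integral_add i1 i2, integral_const_mul,
    integral_reward, integral_nextState, bellman]
  simp

/-- The quadratic form of `Var(Z)`. -/
theorem integral_sq_dotProduct_bellmanNoise
    (hR : ∀ s a, Integrable (fun x : ℝ => |x| ^ 4) (M.R s a)) (v : S × A → ℝ) :
    ∫ z, (M.bellmanNoise z ⬝ᵥ v) ^ 2 ∂M.sampleLaw = v ⬝ᵥ M.noiseCov.mulVec v := by
  have hint : ∀ x y, Integrable
      (fun z => v x * (M.bellmanNoise z x * M.bellmanNoise z y * v y)) M.sampleLaw := fun x y =>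
    (((M.memLp_bellmanNoise hR x).integrable_mul (M.memLp_bellmanNoise hR y)).mul_const
      (v y)).const_mul (v x)
  have e : ∀ z, (M.bellmanNoise z ⬝ᵥ v) ^ 2
      = ∑ x, ∑ y, v x * (M.bellmanNoise z x * M.bellmanNoise z y * v y) := fun z => by
    rw [dotProduct, sq, Finset.sum_mul_sum]
    exact Finset.sum_congr rfl fun x _ => Finset.sum_congr rfl fun y _ => by ring
  simp only [e]
  rw [integral_finsetSum _ fun x _ => integrable_finsetSum _ fun y _ => hint x y, dotProduct]
  refine Finset.sum_congr rfl fun x _ => ?_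
  rw [integral_finsetSum _ fun y _ => hint x y, Matrix.mulVec, dotProduct, Finset.mul_sum]
  refine Finset.sum_congr rfl fun y _ => ?_
  rw [integral_const_mul, integral_mul_const, noiseCov, Matrix.of_apply]

theorem posSemidef_noiseCov (hR : ∀ s a, Integrable (fun x : ℝ => |x| ^ 4) (M.R s a)) :
    M.noiseCov.PosSemidef := by
  refine Matrix.PosSemidef.of_dotProduct_mulVec_nonneg ?_ fun v => ?_
  · ext x y
    simp only [Matrix.conjTranspose_apply, noiseCov, Matrix.of_apply, star_trivial]
    exact integral_congr_ae (ae_of_all _ fun z => mul_comm _ _)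
  · rw [star_trivial, ← M.integral_sq_dotProduct_bellmanNoise hR v]
    exact integral_nonneg fun z => sq_nonneg _

theorem posSemidef_asympVar [DecidableEq S] [DecidableEq A]
    (hR : ∀ s a, Integrable (fun x : ℝ => |x| ^ 4) (M.R s a)) (π : Policy S A) :
    (M.asympVar π).PosSemidef := by
  have h := (M.posSemidef_noiseCov hR).mul_mul_conjTranspose_same (1 - M.γ • M.policyMatrix π)⁻¹
  rwa [Matrix.conjTranspose_eq_transpose_of_trivial] at h

end Samples

/-! ### The history of the samples -/

section History

/-- The σ-algebra generated by the samples up to time `t`. -/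
noncomputable abbrev history {Ω β : Type*} [MeasurableSpace β] (ζ : ℕ → Ω → β) (t : ℕ) :
    MeasurableSpace Ω :=
  ⨆ i ∈ Set.Iic t, MeasurableSpace.comap (ζ i) inferInstance

variable {Ω β : Type*} [MeasurableSpace β] {ζ : ℕ → Ω → β}

theorem measurable_history {i t : ℕ} (h : i ≤ t) : Measurable[history ζ t] (ζ i) :=
  Measurable.of_comap_le
    (le_iSup₂ (f := fun i (_ : i ∈ Set.Iic t) => MeasurableSpace.comap (ζ i) inferInstance) i h)

theorem history_mono {s t : ℕ} (h : s ≤ t) : history ζ s ≤ history ζ t :=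
  iSup₂_le fun _ hi => (measurable_history (ζ := ζ) (le_trans hi h)).comap_le

theorem history_le [mΩ : MeasurableSpace Ω] (hm : ∀ t, Measurable (ζ t)) (t : ℕ) :
    history ζ t ≤ mΩ :=
  iSup₂_le fun _ _ => (hm _).comap_le

/-- Functions of the samples up to time `t` are independent of functions of the next sample. -/
theorem indepFun_of_history [MeasurableSpace Ω] {μ : Measure Ω} (hm : ∀ t, Measurable (ζ t))
    (hindep : iIndepFun ζ μ) {α α' : Type*} [MeasurableSpace α] [MeasurableSpace α'] {t : ℕ}
    {U : Ω → α} (hU : Measurable[history ζ t] U) {g : β → α'} (hg : Measurable g) :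
    IndepFun U (fun ω => g (ζ (t + 1) ω)) μ := by
  have h := indep_iSup_of_disjoint (fun i => (hm i).comap_le) hindep.iIndep
    (S := Set.Iic t) (T := {t + 1}) (by simp)
  rw [IndepFun_iff_Indep]
  refine indep_of_indep_of_le_left (indep_of_indep_of_le_right h ?_) hU.comap_le
  rw [iSup_singleton]
  exact (hg.comp (comap_measurable (ζ (t + 1)))).comap_le

end History

section Iterates

variable {S A : Type*} (M : FiniteMDP S A) [Fintype S] [MeasurableSpace S]
  [DiscreteMeasurableSpace S] [Fintype A] [Nonempty A] {Ω : Type*}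
  {ζ : ℕ → Ω → S × A → ℝ × S}

theorem measurable_qIter (η : ℕ → ℝ) (Q₀ : S × A → ℝ) (t : ℕ) :
    Measurable[history ζ t] fun ω => M.qIter η Q₀ (fun t => ζ t ω) t := by
  induction t with
  | zero => exact measurable_const
  | succ t ih =>
    have h1 := ih.mono (history_mono (ζ := ζ) (Nat.le_succ t)) le_rfl
    have h2 := M.measurable_empBellman.comp
      ((measurable_history (ζ := ζ) (le_refl (t + 1))).prodMk h1)
    exact (h1.const_smul (1 - η (t + 1))).add (h2.const_smul (η (t + 1)))

theorem measurable_noiseIter [MeasurableSpace A] [DiscreteMeasurableSpace A] (η : ℕ → ℝ) (t : ℕ) :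
    Measurable[history ζ t] fun ω => M.noiseIter η (fun t => ζ t ω) t := by
  induction t with
  | zero => exact measurable_const
  | succ t ih =>
    have h1 := ih.mono (history_mono (ζ := ζ) (Nat.le_succ t)) le_rfl
    have h2 := M.measurable_bellmanNoise.comp (measurable_history (ζ := ζ) (le_refl (t + 1)))
    exact (h1.const_smul (1 - η (t + 1))).add (h2.const_smul (η (t + 1)))

end Iterates

end FiniteMDP

/-! ### Mean square bounds for Q-learning -/

theorem sq_norm_le_sum_sq {ι : Type*} [Fintype ι] (v : ι → ℝ) : ‖v‖ ^ 2 ≤ ∑ i, v i ^ 2 := by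
  have hs : 0 ≤ ∑ i, v i ^ 2 := Finset.sum_nonneg fun i _ => sq_nonneg _
  have h : ‖v‖ ≤ √(∑ i, v i ^ 2) := (pi_norm_le_iff_of_nonneg (Real.sqrt_nonneg _)).2 fun i =>
    Real.le_sqrt_of_sq_le (by
      rw [Real.norm_eq_abs, sq_abs]
      exact Finset.single_le_sum (f := fun i => v i ^ 2) (fun i _ => sq_nonneg _)
        (Finset.mem_univ i))
  calc ‖v‖ ^ 2 ≤ √(∑ i, v i ^ 2) ^ 2 := pow_le_pow_left₀ (norm_nonneg _) h 2
    _ = _ := Real.sq_sqrt hs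

theorem memLp_norm_pi {Ω ι : Type*} [MeasurableSpace Ω] {μ : Measure Ω} [Fintype ι]
    {f : Ω → ι → ℝ} (h : ∀ i, MemLp (fun ω => f ω i) 2 μ) : MemLp (fun ω => ‖f ω‖) 2 μ := by
  have hf : AEMeasurable f μ := aemeasurable_pi_iff.2 fun i => (h i).1.aemeasurable
  refine (memLp_finsetSum Finset.univ fun i _ => (h i).norm).mono hf.norm.aestronglyMeasurable
    (ae_of_all _ fun ω => ?_)
  rw [norm_norm]
  refine le_trans ?_ (Real.le_norm_self _)
  refine (pi_norm_le_iff_of_nonneg (Finset.sum_nonneg fun i _ => norm_nonneg _)).2 fun i => ?_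
  exact Finset.single_le_sum (f := fun i => ‖f ω i‖) (fun i _ => norm_nonneg _)
    (Finset.mem_univ i)

namespace FiniteMDP

section MeanSquare

variable {S A : Type*} [Fintype S] [MeasurableSpace S] [Fintype A] {M : FiniteMDP S A}
  {Ω : Type*} [MeasurableSpace Ω] {μ : Measure Ω}
  {ζ : ℕ → Ω → S × A → ℝ × S}

/-- `ζ` is a sequence of independent draws from the generative model, as measurable functions. -/
structure IsSampleSequence (M : FiniteMDP S A) (μ : Measure Ω)
    (ζ : ℕ → Ω → S × A → ℝ × S) : Prop where
  measurable : ∀ t, Measurable (ζ t)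
  map_eq : ∀ t, μ.map (ζ t) = M.sampleLaw
  indep : iIndepFun ζ μ

namespace IsSampleSequence

theorem measurePreserving (h : M.IsSampleSequence μ ζ) (t : ℕ) :
    MeasurePreserving (ζ t) μ M.sampleLaw :=
  ⟨h.measurable t, h.map_eq t⟩

theorem integral_comp (h : M.IsSampleSequence μ ζ) (t : ℕ) {f : (S × A → ℝ × S) → ℝ}
    (hf : Measurable f) : ∫ ω, f (ζ t ω) ∂μ = ∫ z, f z ∂M.sampleLaw := by
  rw [← h.map_eq t, integral_map (h.measurable t).aemeasurable hf.aestronglyMeasurable]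

variable [DiscreteMeasurableSpace S] [Nonempty A]

theorem measurable_qIter (h : M.IsSampleSequence μ ζ) (η : ℕ → ℝ) (Q₀ : S × A → ℝ) (t : ℕ) :
    Measurable fun ω => M.qIter η Q₀ (fun t => ζ t ω) t :=
  (M.measurable_qIter η Q₀ t).mono (history_le h.measurable t) le_rfl

variable [MeasurableSpace A] [DiscreteMeasurableSpace A]

theorem measurable_noiseIter (h : M.IsSampleSequence μ ζ) (η : ℕ → ℝ) (t : ℕ) :
    Measurable fun ω => M.noiseIter η (fun t => ζ t ω) t :=
  (M.measurable_noiseIter η t).mono (history_le h.measurable t) le_rfl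

theorem memLp_bellmanNoise (h : M.IsSampleSequence μ ζ)
    (hR : ∀ s a, Integrable (fun x : ℝ => |x| ^ 4) (M.R s a)) (t : ℕ) (x : S × A) :
    MemLp (fun ω => M.bellmanNoise (ζ t ω) x) 2 μ :=
  (M.memLp_bellmanNoise hR x).comp_measurePreserving (h.measurePreserving t)

theorem memLp_noiseIter (h : M.IsSampleSequence μ ζ)
    (hR : ∀ s a, Integrable (fun x : ℝ => |x| ^ 4) (M.R s a)) (η : ℕ → ℝ) (t : ℕ) (x : S × A) :
    MemLp (fun ω => M.noiseIter η (fun t => ζ t ω) t x) 2 μ := by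
  induction t with
  | zero => exact MemLp.zero'
  | succ t ih =>
    exact (ih.const_mul (1 - η (t + 1))).add
      ((h.memLp_bellmanNoise hR (t + 1) x).const_mul (η (t + 1)))

theorem memLp_norm_noiseIter (h : M.IsSampleSequence μ ζ)
    (hR : ∀ s a, Integrable (fun x : ℝ => |x| ^ 4) (M.R s a)) (η : ℕ → ℝ) (t : ℕ) :
    MemLp (fun ω => ‖M.noiseIter η (fun t => ζ t ω) t‖) 2 μ :=
  memLp_norm_pi (h.memLp_noiseIter hR η t)

variable {η : ℕ → ℝ}

/-- In each coordinate the independence of `N_t` and `Z_{t+1}` gives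
`E N_{t+1}² = (1 - η_{t+1})² E N_t² + η_{t+1}² E Z²`. -/
theorem exists_integral_sq_noiseIter_le (h : M.IsSampleSequence μ ζ)
    (hR : ∀ s a, Integrable (fun x : ℝ => |x| ^ 4) (M.R s a)) (hη : StepSizeCondition η) :
    ∃ B : ℝ, 0 ≤ B ∧ ∀ t, ∫ ω, ‖M.noiseIter η (fun t => ζ t ω) t‖ ^ 2 ∂μ ≤ B * η t := by
  have hx : ∀ x : S × A, ∃ B : ℝ, 0 ≤ B ∧
      ∀ t, ∫ ω, M.noiseIter η (fun t => ζ t ω) t x ^ 2 ∂μ ≤ B * η t := by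
    intro x
    have hZm : Measurable fun z => M.bellmanNoise z x :=
      (measurable_pi_apply x).comp M.measurable_bellmanNoise
    refine hη.exists_le_mul_of_recursion (c := 1)
      (K := ∫ z, M.bellmanNoise z x ^ 2 ∂M.sampleLaw) one_pos le_rfl fun t => ?_
    have hN : Measurable[history ζ t] fun ω => M.noiseIter η (fun t => ζ t ω) t x :=
      (measurable_pi_apply x).comp (M.measurable_noiseIter η t)
    have e := integral_sq_add_mul_of_indepFun (h.memLp_noiseIter hR η t x)
      (h.memLp_bellmanNoise hR (t + 1) x) (indepFun_of_history h.measurable h.indep hN hZm)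
      ((h.integral_comp (t + 1) hZm).trans (M.integral_bellmanNoise hR x))
      (1 - η (t + 1)) (η (t + 1))
    rw [h.integral_comp (t + 1) (hZm.pow_const 2)] at e
    refine (le_of_eq e).trans (add_le_add ?_ ?_)
    · refine mul_le_mul_of_nonneg_right ?_ (integral_nonneg fun ω => sq_nonneg _)
      nlinarith [hη.pos (t + 1), hη.le_one (t + 1)]
    · rw [mul_comm]
      refine mul_le_mul_of_nonneg_left ?_ (integral_nonneg fun ω => sq_nonneg _)
      rw [sq]
      exact mul_le_mul_of_nonneg_right (hη.antitone (Nat.le_succ t)) (hη.pos _).le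
  choose B hB0 hB using hx
  refine ⟨∑ x, B x, Finset.sum_nonneg fun x _ => hB0 x, fun t => ?_⟩
  calc ∫ ω, ‖M.noiseIter η (fun t => ζ t ω) t‖ ^ 2 ∂μ
      ≤ ∫ ω, ∑ x, M.noiseIter η (fun t => ζ t ω) t x ^ 2 ∂μ :=
        integral_mono (h.memLp_norm_noiseIter hR η t).integrable_sq
          (integrable_finsetSum _ fun x _ => (h.memLp_noiseIter hR η t x).integrable_sq)
          fun ω => sq_norm_le_sum_sq _
    _ = ∑ x, ∫ ω, M.noiseIter η (fun t => ζ t ω) t x ^ 2 ∂μ :=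
        integral_finsetSum _ fun x _ => (h.memLp_noiseIter hR η t x).integrable_sq
    _ ≤ ∑ x, B x * η t := Finset.sum_le_sum fun x _ => hB x t
    _ = _ := (Finset.sum_mul _ _ _).symm

variable [IsProbabilityMeasure μ]

theorem memLp_norm_sub_noiseIter (h : M.IsSampleSequence μ ζ)
    (hR : ∀ s a, Integrable (fun x : ℝ => |x| ^ 4) (M.R s a)) (hη : StepSizeCondition η)
    (Q₀ : S × A → ℝ) (t : ℕ) :
    MemLp (fun ω => ‖M.qIter η Q₀ (fun t => ζ t ω) t - M.optQ
      - M.noiseIter η (fun t => ζ t ω) t‖) 2 μ := by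
  induction t with
  | zero => exact memLp_const ‖Q₀ - M.optQ - 0‖
  | succ t ih =>
    have hm := (((h.measurable_qIter η Q₀ (t + 1)).sub_const M.optQ).sub
      (h.measurable_noiseIter η (t + 1))).norm
    refine ((ih.const_mul (1 - (1 - M.γ) * η (t + 1))).add
      ((h.memLp_norm_noiseIter hR η t).const_mul (η (t + 1) * M.γ))).mono
      hm.aestronglyMeasurable (ae_of_all _ fun ω => ?_)
    rw [norm_norm]
    exact (M.norm_sub_noiseIter_succ_le (fun t => (hη.pos t).le) hη.le_one Q₀ _ t).trans
      (Real.le_norm_self _)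

theorem memLp_norm_qIter_sub (h : M.IsSampleSequence μ ζ)
    (hR : ∀ s a, Integrable (fun x : ℝ => |x| ^ 4) (M.R s a)) (hη : StepSizeCondition η)
    (Q₀ : S × A → ℝ) (t : ℕ) :
    MemLp (fun ω => ‖M.qIter η Q₀ (fun t => ζ t ω) t - M.optQ‖) 2 μ := by
  have hm := ((h.measurable_qIter η Q₀ t).sub_const M.optQ).norm
  refine ((h.memLp_norm_sub_noiseIter hR hη Q₀ t).add (h.memLp_norm_noiseIter hR η t)).mono
    hm.aestronglyMeasurable (ae_of_all _ fun ω => ?_)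
  rw [norm_norm]
  refine le_trans ?_ (Real.le_norm_self _)
  simpa using norm_add_le (M.qIter η Q₀ (fun t => ζ t ω) t - M.optQ
      - M.noiseIter η (fun t => ζ t ω) t) (M.noiseIter η (fun t => ζ t ω) t)

/-- The mean square error of Q-learning is `O(η_t)`: the deviation from the noise average inherits
the rate of the noise average. -/
theorem exists_integral_sq_norm_qIter_sub_le (h : M.IsSampleSequence μ ζ)
    (hR : ∀ s a, Integrable (fun x : ℝ => |x| ^ 4) (M.R s a)) (hη : StepSizeCondition η)
    (Q₀ : S × A → ℝ) : ∃ B : ℝ, 0 ≤ B ∧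
      ∀ t, ∫ ω, ‖M.qIter η Q₀ (fun t => ζ t ω) t - M.optQ‖ ^ 2 ∂μ ≤ B * η t := by
  obtain ⟨B₁, hB₁, h₁⟩ := h.exists_integral_sq_noiseIter_le hR hη
  have hγ : 0 < 1 - M.γ := sub_pos.2 M.γ_lt_one
  have hγ1 : 1 - M.γ ≤ 1 := by linarith [M.γ_pos]
  obtain ⟨B₂, hB₂, h₂⟩ := hη.exists_le_mul_of_recursion (c := 1 - M.γ)
    (K := M.γ ^ 2 / (1 - M.γ) * B₁)
    (w := fun t => ∫ ω, ‖M.qIter η Q₀ (fun t => ζ t ω) t - M.optQ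
      - M.noiseIter η (fun t => ζ t ω) t‖ ^ 2 ∂μ) hγ hγ1 fun t => by
    have i0 := (h.memLp_norm_sub_noiseIter hR hη Q₀ (t + 1)).integrable_sq
    have i1 := (h.memLp_norm_sub_noiseIter hR hη Q₀ t).integrable_sq.const_mul
      (1 - (1 - M.γ) * η (t + 1))
    have i2 := (h.memLp_norm_noiseIter hR η t).integrable_sq.const_mul
      (η (t + 1) * (M.γ ^ 2 / (1 - M.γ)))
    have hle := integral_mono i0 (i1.fun_add i2) fun ω =>
      M.sq_norm_sub_noiseIter_succ_le (fun t => (hη.pos t).le) hη.le_one Q₀ (fun t => ζ t ω) t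
    rw [integral_add i1 i2, integral_const_mul, integral_const_mul] at hle
    refine hle.trans (add_le_add le_rfl ?_)
    have := mul_le_mul_of_nonneg_left (h₁ t)
      (show 0 ≤ η (t + 1) * (M.γ ^ 2 / (1 - M.γ)) from
        mul_nonneg (hη.pos _).le (div_nonneg (sq_nonneg _) hγ.le))
    linarith
  refine ⟨2 * B₂ + 2 * B₁, by positivity, fun t => ?_⟩
  have i0 := (h.memLp_norm_qIter_sub hR hη Q₀ t).integrable_sq
  have i1 := (h.memLp_norm_sub_noiseIter hR hη Q₀ t).integrable_sq.const_mul 2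
  have i2 := (h.memLp_norm_noiseIter hR η t).integrable_sq.const_mul 2
  have hle := integral_mono i0 (i1.fun_add i2) fun ω => by
    have hn := norm_add_le (M.qIter η Q₀ (fun t => ζ t ω) t - M.optQ
      - M.noiseIter η (fun t => ζ t ω) t) (M.noiseIter η (fun t => ζ t ω) t)
    rw [sub_add_cancel] at hn
    have := pow_le_pow_left₀ (norm_nonneg _) hn 2
    exact this.trans (add_sq_le.trans_eq (mul_add _ _ _))
  rw [integral_add i1 i2, integral_const_mul, integral_const_mul] at hle
  have h2t : ∫ ω, ‖M.qIter η Q₀ (fun t => ζ t ω) t - M.optQ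
      - M.noiseIter η (fun t => ζ t ω) t‖ ^ 2 ∂μ ≤ B₂ * η t := h₂ t
  linarith [h₁ t]

/-- The fluctuation of the sampled next states is a sum of orthogonal increments, since `Q_t`
depends on the samples up to time `t` only. -/
theorem integral_abs_sum_nextStateDev_le (h : M.IsSampleSequence μ ζ)
    (hR : ∀ s a, Integrable (fun x : ℝ => |x| ^ 4) (M.R s a)) (hη : StepSizeCondition η)
    (Q₀ : S × A → ℝ) (x : S × A) (s : S) (T : ℕ) :
    MemLp (fun ω => ∑ t ∈ Finset.range T, (greedyValue (M.qIter η Q₀ (fun t => ζ t ω) t) s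
        - greedyValue M.optQ s) * M.nextStateDev (ζ (t + 1) ω) x s) 2 μ ∧
    ∫ ω, |∑ t ∈ Finset.range T, (greedyValue (M.qIter η Q₀ (fun t => ζ t ω) t) s
        - greedyValue M.optQ s) * M.nextStateDev (ζ (t + 1) ω) x s| ∂μ
      ≤ √(∑ t ∈ Finset.range T,
        ∫ ω, ‖M.qIter η Q₀ (fun t => ζ t ω) t - M.optQ‖ ^ 2 ∂μ) := by
  set X : ℕ → Ω → ℝ := fun t ω => greedyValue (M.qIter η Q₀ (fun t => ζ t ω) t) s
        - greedyValue M.optQ s with hX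
  set B : ℕ → Ω → ℝ := fun t ω => M.nextStateDev (ζ (t + 1) ω) x s with hB
  have hg : Measurable fun Q : S × A → ℝ => greedyValue Q s :=
    measurable_greedyValue.comp (measurable_id.prodMk measurable_const)
  have hXh : ∀ t, Measurable[history ζ t] (X t) := fun t =>
    (hg.comp (M.measurable_qIter η Q₀ t)).sub_const _
  have hXle : ∀ t ω, |X t ω| ≤ ‖M.qIter η Q₀ (fun t => ζ t ω) t - M.optQ‖ := fun t ω =>
    abs_greedyValue_sub_le _ _ s
  have hXL : ∀ t, MemLp (X t) 2 μ := fun t =>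
    (h.memLp_norm_qIter_sub hR hη Q₀ t).mono
      ((hXh t).mono (history_le h.measurable t) le_rfl).aestronglyMeasurable
      (ae_of_all _ fun ω => by rw [norm_norm]; exact hXle t ω)
  have hBm : ∀ t, Measurable (B t) := fun t =>
    (M.measurable_nextStateDev x s).comp (h.measurable (t + 1))
  have hBle : ∀ t ω, |B t ω| ≤ 1 := fun t ω => M.abs_nextStateDev_le _ x s
  have hBh : ∀ t, Measurable[history ζ (t + 1)] (B t) := fun t =>
    (M.measurable_nextStateDev x s).comp (measurable_history le_rfl)
  have hsumh : ∀ T, Measurable[history ζ T] fun ω => ∑ t ∈ Finset.range T, X t ω * B t ω := by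
    intro T
    refine Finset.measurable_fun_sum _ fun t ht => ?_
    have htT : t + 1 ≤ T := Finset.mem_range.1 ht
    exact ((hXh t).mono (history_mono (by omega)) le_rfl).mul
      ((hBh t).mono (history_mono htT) le_rfl)
  have hL : MemLp (fun ω => ∑ t ∈ Finset.range T, X t ω * B t ω) 2 μ :=
    memLp_finsetSum _ fun t _ => (hXL t).mono ((hXL t).1.mul (hBm t).aestronglyMeasurable)
      (ae_of_all _ fun ω => by
        rw [norm_mul]
        exact mul_le_of_le_one_right (norm_nonneg _) (hBle t ω))
  refine ⟨hL, (integral_abs_le_sqrt hL).trans (Real.sqrt_le_sqrt ?_)⟩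
  refine (integral_sq_sum_mul_le hXL (fun t => (hBm t).aestronglyMeasurable) hBle (fun t => ?_)
    (fun T => ?_) T).trans (Finset.sum_le_sum fun t _ => ?_)
  · exact (h.integral_comp (t + 1) (M.measurable_nextStateDev x s)).trans
      (M.integral_nextStateDev x s)
  · exact indepFun_of_history h.measurable h.indep ((hsumh T).prodMk (hXh T))
      (M.measurable_nextStateDev x s)
  · refine integral_mono (hXL t).integrable_sq (h.memLp_norm_qIter_sub hR hη Q₀ t).integrable_sq
      fun ω => ?_
    simpa only [sq_abs] using pow_le_pow_left₀ (abs_nonneg _) (hXle t ω) 2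

end IsSampleSequence

end MeanSquare

end FiniteMDP

/-! ### Asymptotic normality -/

theorem tendstoInMeasure_zero_of_norm_le {Ω E : Type*} [MeasurableSpace Ω] {μ : Measure Ω}
    [NormedAddCommGroup E] {f : ℕ → Ω → E} (hf : ∀ n, AEStronglyMeasurable (f n) μ)
    {r : ℕ → Ω → ℝ} (hr : ∀ n, Integrable (r n) μ) (hfr : ∀ n ω, ‖f n ω‖ ≤ r n ω)
    (hlim : Tendsto (fun n => ∫ ω, r n ω ∂μ) atTop (𝓝 0)) : TendstoInMeasure μ f atTop 0 := by
  refine tendstoInMeasure_of_tendsto_eLpNorm one_ne_zero hf aestronglyMeasurable_zero ?_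
  have h := ENNReal.tendsto_ofReal hlim
  rw [ENNReal.ofReal_zero] at h
  refine tendsto_of_tendsto_of_tendsto_of_le_of_le tendsto_const_nhds h (fun _ => zero_le)
    fun n => ?_
  have h0 : ∀ ω, 0 ≤ r n ω := fun ω => (norm_nonneg _).trans (hfr n ω)
  have e : ENNReal.ofReal (∫ ω, r n ω ∂μ) = eLpNorm (r n) 1 μ := by
    rw [eLpNorm_one_eq_lintegral_enorm, ← ofReal_integral_norm_eq_lintegral_enorm (hr n)]
    simp only [Real.norm_of_nonneg (h0 _)]
  rw [sub_zero]
  exact (eLpNorm_mono_real (hfr n)).trans e.ge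

theorem exists_norm_toLp_le (ι : Type*) [Fintype ι] :
    ∃ K : ℝ, 0 ≤ K ∧ ∀ v : ι → ℝ, ‖(WithLp.toLp 2 v : EuclideanSpace ℝ ι)‖ ≤ K * ‖v‖ :=
  ⟨‖((EuclideanSpace.equiv ι ℝ).symm : (ι → ℝ) →L[ℝ] EuclideanSpace ℝ ι)‖, norm_nonneg _,
    fun v => ((EuclideanSpace.equiv ι ℝ).symm : (ι → ℝ) →L[ℝ] EuclideanSpace ℝ ι).le_opNorm v⟩

namespace FiniteMDP

section Normality

variable {S A : Type*} [Fintype S] [MeasurableSpace S] [DiscreteMeasurableSpace S]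
  [Fintype A] [MeasurableSpace A] [DiscreteMeasurableSpace A] [Nonempty A]
  {M : FiniteMDP S A} {Ω : Type*} [MeasurableSpace Ω] {μ : Measure Ω} [IsProbabilityMeasure μ]
  {ζ : ℕ → Ω → S × A → ℝ × S} {η : ℕ → ℝ}

namespace IsSampleSequence

/-- After multiplication by `T^{-1/2}` the boundary terms and the sum by parts are of order
`(T η_T)^{-1/2}`, the fluctuation of order `(T⁻¹ ∑ η_t)^{1/2}` and the linearization errors of order
`T^{-1/2} ∑ η_t`. -/
theorem tendsto_integral_averagingRemainder (h : M.IsSampleSequence μ ζ)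
    (hR : ∀ s a, Integrable (fun x : ℝ => |x| ^ 4) (M.R s a)) (hη : StepSizeCondition η)
    (Q₀ : S × A → ℝ) :
    (∀ T, Integrable (fun ω => M.averagingRemainder η Q₀ (fun t => ζ t ω) T) μ) ∧
      Tendsto (fun T => ∫ ω, M.averagingRemainder η Q₀ (fun t => ζ t ω) T ∂μ) atTop (𝓝 0) := by
  obtain ⟨B, hB0, hB⟩ := h.exists_integral_sq_norm_qIter_sub_le hR hη Q₀
  obtain ⟨C, hC0, hC⟩ := hη.exists_sum_sqrt_mul_le
  set d : ℕ → Ω → ℝ := fun t ω => ‖M.qIter η Q₀ (fun t => ζ t ω) t - M.optQ‖ with hd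
  have hdL : ∀ t, MemLp (d t) 2 μ := fun t => h.memLp_norm_qIter_sub hR hη Q₀ t
  have hdi : ∀ t, Integrable (d t) μ := fun t => (hdL t).integrable one_le_two
  have hinv : ∀ t, 0 ≤ 1 / η (t + 1) - 1 / η t := fun t =>
    sub_nonneg.2 (one_div_le_one_div_of_le (hη.pos _) (hη.antitone (Nat.le_succ t)))
  have hd1 : ∀ t, ∫ ω, d t ω ∂μ ≤ √B * √(η t) := by
    intro t
    have h1 := integral_abs_le_sqrt (hdL t)
    simp only [hd, abs_norm] at h1
    exact h1.trans ((Real.sqrt_le_sqrt (hB t)).trans_eq (Real.sqrt_mul hB0 _))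
  have hdinv : ∀ t, ∫ ω, 1 / η t * d t ω ∂μ ≤ √B * (1 / √(η t)) := by
    intro t
    rw [integral_const_mul]
    refine (mul_le_mul_of_nonneg_left (hd1 t) (one_div_pos.2 (hη.pos t)).le).trans_eq ?_
    rw [one_div_mul_eq_div, mul_div_assoc, Real.sqrt_div_self']
  set F : S × A → S → ℕ → Ω → ℝ := fun x s T ω => ∑ t ∈ Finset.range T,
    (greedyValue (M.qIter η Q₀ (fun t => ζ t ω) t) s - greedyValue M.optQ s)
      * M.nextStateDev (ζ (t + 1) ω) x s with hF
  have hFi : ∀ x s T, Integrable (fun ω => |F x s T ω|) μ := fun x s T =>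
    ((h.integral_abs_sum_nextStateDev_le hR hη Q₀ x s T).1.integrable one_le_two).norm
  have hF1 : ∀ x s T, ∫ ω, |F x s T ω| ∂μ ≤ √(B * ∑ t ∈ Finset.range T, η t) := fun x s T => by
    refine (h.integral_abs_sum_nextStateDev_le hR hη Q₀ x s T).2.trans (Real.sqrt_le_sqrt ?_)
    rw [Finset.mul_sum]
    exact Finset.sum_le_sum fun t _ => hB t
  have i1 : ∀ T, Integrable (fun ω => ∑ t ∈ Finset.range T,
      (1 / η (t + 1) - 1 / η t) * d t ω) μ := fun T =>
    integrable_finsetSum _ fun t _ => (hdi t).const_mul _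
  have i2 : Integrable (fun ω => 1 / η 0 * d 0 ω) μ := (hdi 0).const_mul _
  have i3 : ∀ T, Integrable (fun ω => 1 / η T * d T ω) μ := fun T => (hdi T).const_mul _
  have i4 : ∀ T, Integrable (fun ω => ∑ x, ∑ s, |F x s T ω|) μ := fun T =>
    integrable_finsetSum _ fun x _ => integrable_finsetSum _ fun s _ => hFi x s T
  have i5 : ∀ T, Integrable (fun ω => ∑ t ∈ Finset.range T, d t ω ^ 2) μ := fun T =>
    integrable_finsetSum _ fun t _ => (hdL t).integrable_sq
  have hr : ∀ T, (fun ω => M.averagingRemainder η Q₀ (fun t => ζ t ω) T) = fun ω =>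
      1 / √(T : ℝ) * (∑ t ∈ Finset.range T, (1 / η (t + 1) - 1 / η t) * d t ω
      + 1 / η 0 * d 0 ω + 1 / η T * d T ω + ∑ x, ∑ s, |F x s T ω|
      + ∑ t ∈ Finset.range T, d t ω ^ 2) :=
    fun T => rfl
  have i12 := fun T => (i1 T).fun_add i2
  have i123 := fun T => (i12 T).fun_add (i3 T)
  have i1234 := fun T => (i123 T).fun_add (i4 T)
  have hri : ∀ T, Integrable (fun ω => M.averagingRemainder η Q₀ (fun t => ζ t ω) T) μ := by
    intro T
    rw [hr]
    exact ((i1234 T).fun_add (i5 T)).const_mul _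
  refine ⟨hri, ?_⟩
  have e1 : ∀ T, ∫ ω, ∑ t ∈ Finset.range T, (1 / η (t + 1) - 1 / η t) * d t ω ∂μ
      ≤ √B * (C * (1 / √(η T))) := by
    intro T
    rw [integral_finsetSum _ fun t _ => (hdi t).const_mul _]
    refine le_trans (Finset.sum_le_sum fun t _ => ?_)
      ((Finset.mul_sum _ _ _).symm.trans_le
        (mul_le_mul_of_nonneg_left (hC T) (Real.sqrt_nonneg B)))
    rw [integral_const_mul]
    exact (mul_le_mul_of_nonneg_left (hd1 t) (hinv t)).trans_eq (by ring)
  have e2 : ∀ T, ∫ ω, 1 / η 0 * d 0 ω ∂μ ≤ √B * (1 / √(η T)) := fun T =>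
    (hdinv 0).trans (mul_le_mul_of_nonneg_left (one_div_le_one_div_of_le
      (Real.sqrt_pos.2 (hη.pos T)) (Real.sqrt_le_sqrt (hη.antitone (Nat.zero_le T))))
      (Real.sqrt_nonneg B))
  have e4 : ∀ T, ∫ ω, ∑ x, ∑ s, |F x s T ω| ∂μ
      ≤ Fintype.card (S × A) * (Fintype.card S * √(B * ∑ t ∈ Finset.range T, η t)) := by
    intro T
    rw [integral_finsetSum _ fun x _ => integrable_finsetSum _ fun s _ => hFi x s T]
    have : ∀ x ∈ (Finset.univ : Finset (S × A)), ∫ ω, ∑ s, |F x s T ω| ∂μ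
        ≤ Fintype.card S * √(B * ∑ t ∈ Finset.range T, η t) := by
      intro x _
      rw [integral_finsetSum _ fun s _ => hFi x s T]
      simpa using Finset.sum_le_card_nsmul Finset.univ _ _ fun s _ => hF1 x s T
    simpa using Finset.sum_le_card_nsmul Finset.univ _ _ this
  have e5 : ∀ T, ∫ ω, ∑ t ∈ Finset.range T, d t ω ^ 2 ∂μ ≤ B * ∑ t ∈ Finset.range T, η t := by
    intro T
    rw [integral_finsetSum _ fun t _ => (hdL t).integrable_sq, Finset.mul_sum]
    exact Finset.sum_le_sum fun t _ => hB t
  have l4 : Tendsto (fun T : ℕ => 1 / √(T : ℝ) * √(B * ∑ t ∈ Finset.range T, η t)) atTop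
      (𝓝 0) := by
    have := ((Real.continuous_sqrt.tendsto _).comp (hη.tendsto_one_div_mul_sum.const_mul B))
    rw [mul_zero, Real.sqrt_zero] at this
    refine this.congr fun T => ?_
    rw [Function.comp_apply, ← mul_assoc, mul_comm B, mul_assoc,
      Real.sqrt_mul (by positivity), Real.sqrt_div zero_le_one, Real.sqrt_one]
  have hlim := ((hη.tendsto_one_div_sqrt_mul_one_div_sqrt.const_mul (√B * (C + 2))).add
    (l4.const_mul ((Fintype.card (S × A) : ℝ) * Fintype.card S))).add
    (hη.tendsto_one_div_sqrt_mul_sum.const_mul B)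
  simp only [mul_zero, add_zero] at hlim
  refine squeeze_zero (fun T => integral_nonneg fun ω => ?_) (fun T => ?_) hlim
  · rw [averagingRemainder]
    have n1 : 0 ≤ ∑ t ∈ Finset.range T, (1 / η (t + 1) - 1 / η t) * d t ω :=
      Finset.sum_nonneg fun t _ => mul_nonneg (hinv t) (norm_nonneg _)
    have n2 : ∀ t, 0 ≤ 1 / η t * d t ω := fun t =>
      mul_nonneg (one_div_pos.2 (hη.pos t)).le (norm_nonneg _)
    have := n2 0
    have := n2 T
    simp only [Pi.zero_apply]
    positivity
  · rw [hr, integral_const_mul, integral_add (i1234 T) (i5 T), integral_add (i123 T) (i4 T),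
      integral_add (i12 T) (i3 T), integral_add (i1 T) i2]
    refine (mul_le_mul_of_nonneg_left (add_le_add (add_le_add (add_le_add (add_le_add (e1 T) (e2 T))
      (hdinv T)) (e4 T)) (e5 T)) (by positivity)).trans (le_of_eq ?_)
    ring

variable [DecidableEq S] [DecidableEq A]

theorem tendstoInDistribution_sum_bellmanNoise (h : M.IsSampleSequence μ ζ)
    (hR : ∀ s a, Integrable (fun x : ℝ => |x| ^ 4) (M.R s a)) (π : Policy S A) :
    TendstoInDistribution (fun (T : ℕ) ω => (√(T : ℝ))⁻¹ • ∑ t ∈ Finset.range T,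
        (WithLp.toLp 2 ((1 - M.γ • M.policyMatrix π)⁻¹.mulVec (M.bellmanNoise (ζ (t + 1) ω))) :
          EuclideanSpace ℝ (S × A)))
      atTop (id : EuclideanSpace ℝ (S × A) → EuclideanSpace ℝ (S × A))
      (fun _ => μ) (multivariateGaussian 0 (M.asympVar π)) := by
  set H := (1 - M.γ • M.policyMatrix π)⁻¹ with hH
  set g : (S × A → ℝ × S) → EuclideanSpace ℝ (S × A) :=
    fun z => WithLp.toLp 2 (H.mulVec (M.bellmanNoise z)) with hg
  have hlin : Continuous fun v : S × A → ℝ =>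
      (WithLp.toLp 2 (H.mulVec v) : EuclideanSpace ℝ (S × A)) :=
    (EuclideanSpace.equiv (S × A) ℝ).symm.continuous.comp
      (Continuous.matrix_mulVec continuous_const continuous_id)
  have hgm : Measurable g := hlin.measurable.comp M.measurable_bellmanNoise
  have hinner : ∀ z u, inner ℝ (g z) u = M.bellmanNoise z ⬝ᵥ H.transpose.mulVec u.ofLp := by
    intro z u
    rw [EuclideanSpace.inner_eq_star_dotProduct, star_trivial, Matrix.dotProduct_mulVec,
      dotProduct_comm, Matrix.mulVec_transpose]
  have hmeas : ∀ v : S × A → ℝ, Measurable fun z => M.bellmanNoise z ⬝ᵥ v := fun v =>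
    Finset.measurable_fun_sum _ fun x _ =>
      ((measurable_pi_apply x).comp M.measurable_bellmanNoise).mul_const _
  refine tendstoInDistribution_multivariateGaussian (W := fun t ω => g (ζ (t + 1) ω)) ?_ ?_ ?_ ?_
    (M.posSemidef_asympVar hR π) ?_
  · exact (h.indep.precomp (add_left_injective 1)).comp (fun _ => g) fun _ => hgm
  · intro t
    have : IdentDistrib (ζ (t + 1)) (ζ (0 + 1)) μ μ :=
      ⟨(h.measurable _).aemeasurable, (h.measurable _).aemeasurable,
        (h.map_eq _).trans (h.map_eq _).symm⟩
    exact this.comp hgm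
  · obtain ⟨K₁, hK₁, h₁⟩ := exists_norm_toLp_le (S × A)
    obtain ⟨K₂, hK₂, h₂⟩ := exists_norm_mulVec_le H
    refine (memLp_norm_pi (h.memLp_bellmanNoise hR 1)).of_le_mul (c := K₁ * K₂)
      (hgm.comp (h.measurable 1)).aestronglyMeasurable (ae_of_all _ fun ω => ?_)
    rw [norm_norm, mul_assoc]
    exact (h₁ _).trans (mul_le_mul_of_nonneg_left (h₂ _) hK₁)
  · intro u
    simp only [hinner]
    rw [h.integral_comp 1 (hmeas _)]
    simp only [dotProduct]
    rw [integral_finsetSum _ fun x _ =>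
      ((M.memLp_bellmanNoise hR x).integrable one_le_two).mul_const _]
    simp only [integral_mul_const, M.integral_bellmanNoise hR, zero_mul, Finset.sum_const_zero]
  · intro u
    simp only [hinner]
    rw [h.integral_comp 1 ((hmeas _).pow_const 2), M.integral_sq_dotProduct_bellmanNoise hR,
      asympVar, ← hH, ← Matrix.mulVec_mulVec, ← Matrix.mulVec_mulVec,
      Matrix.dotProduct_mulVec u.ofLp, Matrix.mulVec_transpose]

theorem tendstoInDistribution_qAvg (h : M.IsSampleSequence μ ζ)
    (hR : ∀ s a, Integrable (fun x : ℝ => |x| ^ 4) (M.R s a)) (hη : StepSizeCondition η)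
    {π : Policy S A} (hπ : M.IsOptimal π) {L : ℝ}
    {greedy : (S × A → ℝ) → Policy S A} (hgreedy : ∀ Q, IsGreedy (greedy Q) Q)
    (hL : ∀ Q : S × A → ℝ,
      ‖(M.policyMatrix (greedy Q) - M.policyMatrix π).mulVec (Q - M.optQ)‖
        ≤ L * ‖Q - M.optQ‖ ^ 2) (Q₀ : S × A → ℝ) :
    TendstoInDistribution (fun (T : ℕ) (ω : Ω) =>
        (WithLp.toLp 2 (√(T : ℝ) • (M.qAvg η Q₀ (fun t => ζ t ω) T - M.optQ)) :
          EuclideanSpace ℝ (S × A)))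
      atTop (id : EuclideanSpace ℝ (S × A) → EuclideanSpace ℝ (S × A))
      (fun _ => μ) (multivariateGaussian 0 (M.asympVar π)) := by
  have hclt := h.tendstoInDistribution_sum_bellmanNoise hR π
  obtain ⟨K₁, hK₁, h₁⟩ := exists_norm_toLp_le (S × A)
  obtain ⟨K₂, -, h₂⟩ := M.exists_norm_qAvg_sub_le hπ hgreedy hL hη Q₀
  obtain ⟨hri, hr⟩ := h.tendsto_integral_averagingRemainder hR hη Q₀
  have hYm : ∀ T : ℕ, Measurable fun ω =>
      (WithLp.toLp 2 (√(T : ℝ) • (M.qAvg η Q₀ (fun t => ζ t ω) T - M.optQ)) :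
        EuclideanSpace ℝ (S × A)) := by
    intro T
    have : Measurable fun ω => √(T : ℝ) • (M.qAvg η Q₀ (fun t => ζ t ω) T - M.optQ) :=
      (((Finset.measurable_fun_sum _ fun t _ => h.measurable_qIter η Q₀ t).const_smul
        (1 / (T : ℝ))).sub_const M.optQ).const_smul (√(T : ℝ))
    exact (EuclideanSpace.equiv (S × A) ℝ).symm.continuous.measurable.comp this
  refine tendstoInDistribution_of_tendstoInMeasure_sub _ _ hclt ?_ fun T => (hYm T).aemeasurable
  refine tendstoInMeasure_zero_of_norm_le
    (fun T => ((hYm T).aemeasurable.sub (hclt.forall_aemeasurable T)).aestronglyMeasurable)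
    (fun T => ((hri T).const_mul K₂).const_mul K₁) (fun T ω => ?_) ?_
  · refine le_trans (le_of_eq ?_) ((h₁ _).trans
      (mul_le_mul_of_nonneg_left (h₂ (fun t => ζ t ω) T) hK₁))
    congr 1
    simp only [Pi.sub_apply, WithLp.toLp_sub, WithLp.toLp_smul, WithLp.toLp_sum]
  · have hlim := (hr.const_mul K₂).const_mul K₁
    rw [mul_zero, mul_zero] at hlim
    exact hlim.congr fun T => by rw [← integral_const_mul, ← integral_const_mul]

end IsSampleSequence

end Normality

end FiniteMDP

theorem mainTheorem8 {S A : Type*}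
    [Fintype S] [DecidableEq S] [MeasurableSpace S] [DiscreteMeasurableSpace S]
    [Fintype A] [DecidableEq A] [MeasurableSpace A] [DiscreteMeasurableSpace A] [Nonempty A]
    (M : FiniteMDP S A)
    -- the rewards have finite fourth moments
    (hR : ∀ s a, Integrable (fun x : ℝ => |x| ^ 4) (M.R s a))
    -- a choice of greedy policies, with any tie-breaking, and the Lipschitz condition for it
    (greedy : (S × A → ℝ) → FiniteMDP.Policy S A)
    (hgreedy : ∀ Q, FiniteMDP.IsGreedy (greedy Q) Q)
    (πstar : FiniteMDP.Policy S A) (hπstar : M.IsOptimal πstar) (L : ℝ)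
    (hL : ∀ Q : S × A → ℝ,
      ‖(M.policyMatrix (greedy Q) - M.policyMatrix πstar).mulVec (Q - M.optQ)‖
        ≤ L * ‖Q - M.optQ‖ ^ 2)
    -- the step sizes
    (η : ℕ → ℝ) (hη : StepSizeCondition η)
    -- the initial point, and the i.i.d. samples of the generative model
    (Q₀ : S × A → ℝ)
    {Ω : Type*} [MeasurableSpace Ω] (μ : Measure Ω) [IsProbabilityMeasure μ]
    (ξ : ℕ → Ω → S × A → ℝ × S)
    (hlaw : ∀ t, HasLaw (ξ t) M.sampleLaw μ)
    (hindep : iIndepFun ξ μ) :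
    IsUnit (1 - M.γ • M.policyMatrix πstar) ∧
    (M.asympVar πstar).PosSemidef ∧
    TendstoInDistribution
      (fun (T : ℕ) (ω : Ω) =>
        (WithLp.toLp 2 (√(T : ℝ) • (M.qAvg η Q₀ (fun t => ξ t ω) T - M.optQ)) :
          EuclideanSpace ℝ (S × A)))
      atTop (id : EuclideanSpace ℝ (S × A) → EuclideanSpace ℝ (S × A))
      (fun _ => μ) (multivariateGaussian 0 (M.asympVar πstar)) := by
  refine ⟨M.isUnit_one_sub_policyMatrix πstar, M.posSemidef_asympVar hR πstar, ?_⟩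
  -- `HasLaw` only provides a.e. measurability; pass to measurable modifications of the samples
  set ζ : ℕ → Ω → S × A → ℝ × S := fun t => (hlaw t).aemeasurable.mk (ξ t) with hζ
  have hae : ∀ t, ξ t =ᵐ[μ] ζ t := fun t => (hlaw t).aemeasurable.ae_eq_mk
  have h : M.IsSampleSequence μ ζ :=
    { measurable := fun t => (hlaw t).aemeasurable.measurable_mk
      map_eq := fun t => (Measure.map_congr (hae t)).symm.trans (hlaw t).map_eq
      indep := hindep.congr hae }
  refine (h.tendstoInDistribution_qAvg hR hη hπstar hgreedy hL Q₀).congr (fun T => ?_)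
    (ae_eq_refl _)
  filter_upwards [ae_all_iff.2 hae] with ω hω
  simp only [hω]
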